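/- Let $\Gamma$ be a finite-index subgroup of $\bar\Gamma$, where $\bar\Gamma\subset \mathrm{SL}_2(\mathbb{R})$ is either $\mathrm{SL}_2(\mathbb{Z})$ or a group $\Gamma_{\mathcal{O}}$ of the following kind. Let $a,b$ be square-free, relatively prime positive integers such that the quaternion algebra $B=\mathbb{Q}+\mathbb{Q}\alpha+\mathbb{Q}\beta+\mathbb{Q}\alpha\beta$ with $\alpha^2=a$, $\beta^2=b$, $\alpha\beta=-\beta\alpha$ is a division algebra, and let $\mathcal{O}$ be a maximal order of $B$; then $\Gamma_{\mathcal{O}}$ is the image of $\{q=q_0+q_1\alpha+q_2\beta+q_3\alpha\beta\in\mathcal{O} : q_0^2-q_1^2a-q_2^2b+q_3^2ab=1\}$ under $$q\mapsto\begin{pmatrix} q_0+q_1\sqrt{a}&q_2\sqrt{b}+q_3\sqrt{ab}\\ q_2\sqrt{b}-q_3\sqrt{ab}&q_0-q_1\sqrt{a}\end{pmatrix}.$$ Let $\mathrm{Prim}(\Gamma)$ be the set of primitive hyperbolic conjugacy classes of $\Gamma$, that is, the conjugacy classes, in the image of $\Gamma$ in $\mathrm{PSL}_2(\mathbb{R})$,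 of hyperbolic elements that are not of the form $\delta^k$ with $\delta$ in that image and $k\ge 2$. Let $\mathrm{tr}$ denote the trace of a lift to $\mathrm{SL}_2(\mathbb{R})$ with nonnegative trace. For a positive integer $n$ put $$m_\Gamma(n):=\sum_{\substack{\gamma\in\mathrm{Prim}(\Gamma),\ j\ge1\\ \mathrm{tr}\,\gamma^j=n}}\frac1j .$$ Then $m_\Gamma(n)\ll_{\epsilon,\Gamma} n^{1+\epsilon}$: for every $\epsilon>0$ there is a constant $C=C(\epsilon,\Gamma)>0$ such that $m_\Gamma(n)\le C\,n^{1+\epsilon}$ for all integers $n\ge 1$; in particular every $m_\Gamma(n)$ is finite. -/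

import Mathlib

open Matrix
open scoped Quaternion ENNReal MatrixGroups

noncomputable section

/-! ### Hyperbolic conjugacy classes and the trace multiplicity

A matrix and its negative act in the same way on the upper half plane, so hyperbolic classes of
`Γ ≤ SL(2, ℝ)` are taken in the image of `Γ` in `PSL(2, ℝ)`, and the trace of such a class is that
of the lift with positive trace. -/

/-- `PSL(2, ℝ) = SL(2, ℝ) / {±1}`. -/
abbrev PSL2R : Type := Matrix.ProjectiveSpecialLinearGroup (Fin 2) ℝ

/-- The image of `Γ ≤ SL(2, ℝ)` in `PSL(2, ℝ)`. -/
def projImage (Γ : Subgroup SL(2, ℝ)) : Subgroup PSL2R :=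
  Γ.map (QuotientGroup.mk' (Subgroup.center SL(2, ℝ)))

theorem abs_trace_eq_of_rel (A B : SL(2, ℝ))
    (h : (QuotientGroup.leftRel (Subgroup.center SL(2, ℝ))).r A B) :
    |(A : Matrix (Fin 2) (Fin 2) ℝ).trace| = |(B : Matrix (Fin 2) (Fin 2) ℝ).trace| := by
  have h' : A⁻¹ * B ∈ Subgroup.center SL(2, ℝ) := QuotientGroup.leftRel_apply.mp h
  obtain ⟨r, hr, hs⟩ := Matrix.SpecialLinearGroup.mem_center_iff.mp h'
  have hB : (B : Matrix (Fin 2) (Fin 2) ℝ) = A * scalar (Fin 2) r := by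
    rw [hs, ← Matrix.SpecialLinearGroup.coe_mul, mul_inv_cancel_left]
  have hr1 : |r| = 1 := by
    have : r ^ 2 = 1 := by simpa using hr
    exact (pow_eq_one_iff_of_nonneg (abs_nonneg r) two_ne_zero).mp (by rw [sq_abs, this])
  rw [hB, Matrix.trace_fin_two, Matrix.trace_fin_two]
  simp [Matrix.mul_apply, ← add_mul, abs_mul, hr1]

/-- The trace of an element of `PSL(2, ℝ)`, i.e. that of a lift to `SL(2, ℝ)` whose trace is
nonnegative: the absolute value of the trace of any lift. -/
def projTrace : PSL2R → ℝ :=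
  Quotient.lift (fun A : SL(2, ℝ) => |(A : Matrix (Fin 2) (Fin 2) ℝ).trace|) abs_trace_eq_of_rel

theorem projTrace_mk (A : SL(2, ℝ)) :
    projTrace (QuotientGroup.mk' (Subgroup.center SL(2, ℝ)) A) = |(A : Matrix (Fin 2) (Fin 2) ℝ).trace| := rfl

theorem projTrace_conj (g x : PSL2R) : projTrace (g * x * g⁻¹) = projTrace x := by
  obtain ⟨A, rfl⟩ := QuotientGroup.mk'_surjective _ g
  obtain ⟨B, rfl⟩ := QuotientGroup.mk'_surjective _ x
  rw [← map_mul, ← map_inv, ← map_mul, projTrace_mk, projTrace_mk, Matrix.SpecialLinearGroup.coe_mul,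
    Matrix.trace_mul_comm, ← Matrix.SpecialLinearGroup.coe_mul]
  simp [← mul_assoc]

/-- `γ ∈ G ≤ PSL(2, ℝ)` is *primitive hyperbolic* in `G`: it is hyperbolic (its trace exceeds `2`)
and is not a proper power of an element of `G`. -/
def IsPrimitiveHyperbolic {G : Subgroup PSL2R} (γ : G) : Prop :=
  2 < projTrace γ ∧ ∀ (δ : G) (k : ℕ), 2 ≤ k → δ ^ k ≠ γ

/-- `Prim(Γ)`: the primitive hyperbolic conjugacy classes of `Γ`. -/
def Prim (Γ : Subgroup SL(2, ℝ)) : Set (ConjClasses (projImage Γ)) :=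
  {c | ∃ γ : projImage Γ, ConjClasses.mk γ = c ∧ IsPrimitiveHyperbolic γ}

/-- The trace of `γ ^ j` for a conjugacy class `γ`. -/
def powTrace {G : Subgroup PSL2R} (c : ConjClasses G) (j : ℕ) : ℝ :=
  Quotient.lift (fun γ : G => projTrace ((γ ^ j : G) : PSL2R)) (by
    intro x y h
    obtain ⟨g, rfl⟩ := isConj_iff.mp h
    simp only [conj_pow, Subgroup.coe_mul, Subgroup.coe_inv, projTrace_conj]) c

/-- The trace multiplicity `m_Γ(n) = ∑ 1 / j` over `γ ∈ Prim(Γ)` and `j ≥ 1` with `tr γ ^ j = n`,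
as a sum of nonnegative terms with values in `[0, ∞]`. -/
def traceMult (Γ : Subgroup SL(2, ℝ)) (n : ℕ) : ℝ≥0∞ :=
  ∑' p : {p : ConjClasses (projImage Γ) × ℕ //
      p.1 ∈ Prim Γ ∧ 1 ≤ p.2 ∧ powTrace p.1 p.2 = n},
    ((p.1.2 : ℝ≥0∞))⁻¹

/-! ### The arithmetic groups -/

/-- `SL(2, ℤ)` as a subgroup of `SL(2, ℝ)`. -/
def modularGroupReal : Subgroup SL(2, ℝ) :=
  (Matrix.SpecialLinearGroup.map (n := Fin 2) (Int.castRingHom ℝ)).range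

/-- The quaternion algebra `ℚ + ℚα + ℚβ + ℚαβ` with `α² = a`, `β² = b`, `αβ = -βα`. -/
abbrev QuatAlg (a b : ℕ) : Type := ℍ[ℚ, (a : ℚ), (b : ℚ)]

/-- An *order*: a subring that is finitely generated over `ℤ` and spans the algebra over `ℚ`. -/
def IsQuatOrder {a b : ℕ} (O : Subalgebra ℤ (QuatAlg a b)) : Prop :=
  (Subalgebra.toSubmodule O).FG ∧ Submodule.span ℚ (O : Set (QuatAlg a b)) = ⊤

/-- The reduced norm `q₀² - q₁² a - q₂² b + q₃² ab`. -/
def quatNorm {a b : ℕ} (q : QuatAlg a b) : ℚ :=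
  q.re ^ 2 - q.imI ^ 2 * a - q.imJ ^ 2 * b + q.imK ^ 2 * (a * b)

/-- The embedding of the quaternion algebra into the real `2 × 2` matrices. -/
def quatMatrix {a b : ℕ} (q : QuatAlg a b) : Matrix (Fin 2) (Fin 2) ℝ :=
  !![(q.re : ℝ) + q.imI * √(a : ℝ), (q.imJ : ℝ) * √(b : ℝ) + q.imK * √((a : ℝ) * b);
     (q.imJ : ℝ) * √(b : ℝ) - q.imK * √((a : ℝ) * b), (q.re : ℝ) - q.imI * √(a : ℝ)]

theorem quatMatrix_one {a b : ℕ} : quatMatrix (1 : QuatAlg a b) = 1 := by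
  ext i j
  fin_cases i <;> fin_cases j <;> simp [quatMatrix]

theorem quatMatrix_mul {a b : ℕ} (p q : QuatAlg a b) :
    quatMatrix (p * q) = quatMatrix p * quatMatrix q := by
  have ha : √(a : ℝ) ^ 2 = a := Real.sq_sqrt (Nat.cast_nonneg a)
  have hb : √(b : ℝ) ^ 2 = b := Real.sq_sqrt (Nat.cast_nonneg b)
  have hab : √((a : ℝ) * b) = √(a : ℝ) * √(b : ℝ) := Real.sqrt_mul (Nat.cast_nonneg a) _
  ext i j
  fin_cases i <;> fin_cases j <;>
    simp [quatMatrix, Matrix.mul_apply, hab] <;> grind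

theorem det_quatMatrix {a b : ℕ} (q : QuatAlg a b) :
    (quatMatrix q).det = (quatNorm q : ℝ) := by
  have ha : √(a : ℝ) ^ 2 = a := Real.sq_sqrt (Nat.cast_nonneg a)
  have hb : √(b : ℝ) ^ 2 = b := Real.sq_sqrt (Nat.cast_nonneg b)
  have hab : √((a : ℝ) * b) = √(a : ℝ) * √(b : ℝ) := Real.sqrt_mul (Nat.cast_nonneg a) _
  rw [Matrix.det_fin_two]
  simp [quatMatrix, quatNorm, hab]
  grind

theorem mul_star_of_quatNorm {a b : ℕ} {q : QuatAlg a b} (hn : quatNorm q = 1) :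
    q * star q = 1 := by
  unfold quatNorm at hn
  ext <;> simp <;> grind

/-- An order contains the conjugate of each of its elements of norm `1`. -/
theorem IsQuatOrder.star_mem {a b : ℕ} {O : Subalgebra ℤ (QuatAlg a b)} (hO : IsQuatOrder O)
    {q : QuatAlg a b} (hq : q ∈ O) (hn : quatNorm q = 1) : star q ∈ O := by
  by_cases him : q.imI = 0 ∧ q.imJ = 0 ∧ q.imK = 0
  · have : star q = q := by ext <;> simp [him]
    rwa [this]
  obtain ⟨p, hp, hpq⟩ := IsIntegral.of_mem_of_fg O hO.1 q hq
  set χ : Polynomial ℚ := .X ^ 2 - .C (2 * q.re) * .X + .C 1 with hχ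
  have hdeg : χ.natDegree = 2 := by rw [hχ]; compute_degree!
  have hmon : χ.Monic := by rw [hχ]; monicity!
  have hχq : Polynomial.aeval q χ = 0 := by
    unfold quatNorm at hn
    simp only [hχ, map_add, map_sub, map_mul, map_pow, Polynomial.aeval_X, Polynomial.aeval_C]
    ext <;> simp [sq, QuaternionAlgebra.algebraMap_eq] <;> grind
  have hpq' : Polynomial.aeval q (p.map (algebraMap ℤ ℚ)) = 0 := by
    rw [Polynomial.aeval_map_algebraMap]; exact hpq
  have hr : Polynomial.aeval q (p.map (algebraMap ℤ ℚ) %ₘ χ) = 0 := by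
    have := congrArg (Polynomial.aeval q) (Polynomial.modByMonic_add_div (p.map (algebraMap ℤ ℚ)) χ)
    rwa [map_add, map_mul, hχq, zero_mul, add_zero, hpq'] at this
  have hlt : (p.map (algebraMap ℤ ℚ) %ₘ χ).natDegree ≤ 1 := by
    have := Polynomial.natDegree_modByMonic_lt (p.map (algebraMap ℤ ℚ)) hmon
      (by intro h; simp [h] at hdeg)
    omega
  obtain ⟨c, d, hcd⟩ := Polynomial.exists_eq_X_add_C_of_natDegree_le_one hlt
  have hz : p.map (algebraMap ℤ ℚ) %ₘ χ = 0 := by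
    rw [hcd] at hr ⊢
    simp only [map_add, map_mul, Polynomial.aeval_X, Polynomial.aeval_C] at hr
    have h0 := congrArg QuaternionAlgebra.re hr
    have h1 := congrArg QuaternionAlgebra.imI hr
    have h2 := congrArg QuaternionAlgebra.imJ hr
    have h3 := congrArg QuaternionAlgebra.imK hr
    simp [QuaternionAlgebra.algebraMap_eq] at h0 h1 h2 h3
    have hc : c = 0 := by tauto
    subst hc
    have hd : d = 0 := by simpa using h0
    simp [hd]
  obtain ⟨g, hg⟩ := IsIntegrallyClosed.eq_map_mul_C_of_dvd ℚ hp
    ((Polynomial.modByMonic_eq_zero_iff_dvd hmon).mp hz)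
  rw [hmon.leadingCoeff, Polynomial.C_1, mul_one] at hg
  have ht : 2 * q.re = ((-g.coeff 1 : ℤ) : ℚ) := by
    have := congrArg (fun f => Polynomial.coeff f 1) hg
    simp [hχ, Polynomial.coeff_one, Polynomial.coeff_X_pow] at this
    push_cast
    linarith
  have hs : star q = algebraMap ℤ (QuatAlg a b) (-g.coeff 1) - q := by
    ext <;> simp
    push_cast at ht
    linarith
  rw [hs]
  exact O.sub_mem (O.algebraMap_mem _) hq

/-- The group `Γ_O`: the image in `SL(2, ℝ)` of the elements of norm `1` of the order `O`. -/
def quatGroup {a b : ℕ} (O : Subalgebra ℤ (QuatAlg a b)) (hO : IsQuatOrder O) :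
    Subgroup SL(2, ℝ) where
  carrier := {g | ∃ q ∈ O, quatNorm q = 1 ∧ quatMatrix q = (g : Matrix (Fin 2) (Fin 2) ℝ)}
  one_mem' := ⟨1, O.one_mem, by simp [quatNorm], by simp [quatMatrix_one]⟩
  mul_mem' := by
    rintro g h ⟨p, hp, hp1, hpg⟩ ⟨q, hq, hq1, hqh⟩
    have hm : quatMatrix (p * q) = ((g * h : SL(2, ℝ)) : Matrix (Fin 2) (Fin 2) ℝ) := by
      rw [quatMatrix_mul, hpg, hqh, Matrix.SpecialLinearGroup.coe_mul]
    refine ⟨p * q, O.mul_mem hp hq, ?_, hm⟩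
    have hd := det_quatMatrix (p * q)
    rw [hm, Matrix.SpecialLinearGroup.det_coe] at hd
    exact_mod_cast hd.symm
  inv_mem' := by
    rintro g ⟨q, hq, hq1, hqg⟩
    have h1 : quatMatrix q * quatMatrix (star q) = 1 := by
      rw [← quatMatrix_mul, mul_star_of_quatNorm hq1, quatMatrix_one]
    have hm : quatMatrix (star q) = ((g⁻¹ : SL(2, ℝ)) : Matrix (Fin 2) (Fin 2) ℝ) := by
      rw [hqg] at h1
      calc quatMatrix (star q) = ((g⁻¹ * g : SL(2, ℝ)) : Matrix (Fin 2) (Fin 2) ℝ) * quatMatrix (star q) := by simp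
        _ = ((g⁻¹ : SL(2, ℝ)) : Matrix (Fin 2) (Fin 2) ℝ) := by rw [Matrix.SpecialLinearGroup.coe_mul, Matrix.mul_assoc, h1, mul_one]
    refine ⟨star q, hO.star_mem hq hq1, ?_, hm⟩
    have hd := det_quatMatrix (star q)
    rw [hm, Matrix.SpecialLinearGroup.det_coe] at hd
    exact_mod_cast hd.symm

/-- `G` is `Γ_𝒪` for a maximal order `𝒪` in a division quaternion algebra `(a, b)` over `ℚ` with
`a`, `b` positive, square-free and relatively prime. -/
def IsQuaternionGroup (G : Subgroup SL(2, ℝ)) : Prop :=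
  ∃ (a b : ℕ) (O : Subalgebra ℤ (QuatAlg a b)) (hO : Maximal IsQuatOrder O),
    0 < a ∧ 0 < b ∧ Squarefree a ∧ Squarefree b ∧ a.Coprime b ∧
      (∀ x : QuatAlg a b, x ≠ 0 → IsUnit x) ∧ G = quatGroup O hO.prop

end

/-! Two estimates give the bound. First, `traceMult_le_card_mul_log`: if a finite set `S` of
matrices meets the `Γ`-conjugates of every element of trace `± n`, then `m_Γ(n) ≤ |S| log₂ n`.
Indeed `(γ, j)` can be recovered from `j` and a conjugate of `γ ^ j` in `S`, because roots of a
hyperbolic matrix are unique up to sign; and traces are integers, so a hyperbolic `γ` has trace at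
least `3` and `2 ^ j ≤ tr γ ^ j = n`.

Second, there is such an `S` of size `O(n ^ (1 + ε))` (`HasSmallConjCovers`). This property passes
to finite-index subgroups, so it is enough to treat the two ambient groups. In both, a reduction
theory bounds one coordinate by `O(n)`, and the determinant equation leaves `O(n ^ ε)` values for
the rest.

For `SL(2, ℤ)`, every class contains a matrix with `bc > 0`. Then `(a - d)² + 4bc = n² - 4` leaves
`O(n)` values of `a - d`, and `c` divides a fixed nonzero integer. For `Γ_O`, cocompactness
(`IsQuatOrder.exists_bounded_translate`) gives a conjugate with `q₃ = O(n)`. Once `q₀` and `q₃` are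
fixed, `q₁` and `q₂` come from a representation of an integer of size `O(n²)` by the definite form
`X² + abY²`, and `card_formReps_le` bounds these by divisor counts. -/

/-! ### Divisor bound and representations by `X² + N Y²`. -/

/-- Compare `e + 1` with `p ^ (ε e)` prime by prime. For `p > 2 ^ (1 / ε)` there is no loss, as `e +
1 ≤ 2 ^ e`; each of the fewer than `P` smaller primes loses at most a factor `K`, by Bernoulli's
inequality. -/
theorem Nat.exists_card_divisors_le_rpow (ε : ℝ) (hε : 0 < ε) :
    ∃ C : ℝ, 1 ≤ C ∧ ∀ m : ℕ, m ≠ 0 → (m.divisors.card : ℝ) ≤ C * (m : ℝ) ^ ε := by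
  set K : ℝ := 1 + 1 / (ε * Real.log 2) with hK
  have hlog : 0 < Real.log 2 := Real.log_pos one_lt_two
  have hK1 : 1 ≤ K := by rw [hK]; have : 0 < 1 / (ε * Real.log 2) := by positivity
                         linarith
  obtain ⟨P, hP⟩ := exists_nat_gt ((2 : ℝ) ^ (1 / ε))
  refine ⟨K ^ P, one_le_pow₀ hK1, fun m hm => ?_⟩
  have hfactor : ∀ p ∈ m.primeFactors, ((m.factorization p + 1 : ℕ) : ℝ) ≤
      (if p < P then K else 1) * ((p ^ m.factorization p : ℕ) : ℝ) ^ ε := by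
    intro p hp
    have hp2 : (2 : ℝ) ≤ p := by exact_mod_cast (Nat.prime_of_mem_primeFactors hp).two_le
    generalize m.factorization p = e
    have hpe : ((p ^ e : ℕ) : ℝ) ^ ε = ((p : ℝ) ^ ε) ^ e := by
      push_cast
      rw [← Real.rpow_natCast, ← Real.rpow_natCast, ← Real.rpow_mul (by positivity),
        ← Real.rpow_mul (by positivity), mul_comm]
    rw [hpe]
    split_ifs with hlt
    · have h1 : 1 + ε * Real.log 2 ≤ (p : ℝ) ^ ε := by
        have : (2 : ℝ) ^ ε ≤ (p : ℝ) ^ ε := Real.rpow_le_rpow (by norm_num) hp2 hε.le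
        refine le_trans ?_ this
        rw [Real.rpow_def_of_pos two_pos]
        linarith [Real.add_one_le_exp (Real.log 2 * ε)]
      set t := ε * Real.log 2 with ht
      have ht0 : 0 < t := by positivity
      have h2 : 1 + e * t ≤ ((p : ℝ) ^ ε) ^ e :=
        (one_add_mul_le_pow (by linarith) e).trans (pow_le_pow_left₀ (by positivity) h1 e)
      calc ((e + 1 : ℕ) : ℝ) ≤ K * (1 + e * t) := by
            rw [hK]; push_cast
            have : (1 + 1 / t) * (1 + e * t) = 1 + e + e * t + 1 / t := by field_simp; ring
            rw [this]
            have : 0 ≤ e * t := by positivity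
            have : 0 < 1 / t := by positivity
            linarith
        _ ≤ _ := by gcongr
    · rw [one_mul]
      have h1 : (2 : ℝ) ≤ (p : ℝ) ^ ε := by
        have : ((2 : ℝ) ^ (1 / ε)) ^ ε ≤ (p : ℝ) ^ ε :=
          Real.rpow_le_rpow (by positivity)
            (hP.le.trans (by exact_mod_cast not_lt.mp hlt)) hε.le
        rwa [← Real.rpow_mul (by norm_num), one_div, inv_mul_cancel₀ hε.ne', Real.rpow_one] at this
      calc ((e + 1 : ℕ) : ℝ) ≤ (2 : ℝ) ^ e := by exact_mod_cast Nat.lt_two_pow_self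
        _ ≤ _ := pow_le_pow_left₀ (by norm_num) h1 e
  rw [Nat.card_divisors hm]
  push_cast
  have hm' : (m : ℝ) ^ ε = ∏ p ∈ m.primeFactors, ((p ^ m.factorization p : ℕ) : ℝ) ^ ε := by
    rw [Real.finsetProd_rpow _ _ (fun _ _ => by positivity)]
    congr 1
    have := Nat.prod_factorization_pow_eq_self hm
    conv_lhs => rw [← this]
    rw [Finsupp.prod, Nat.support_factorization]
    push_cast; rfl
  calc ∏ p ∈ m.primeFactors, ((m.factorization p : ℝ) + 1)
      ≤ ∏ p ∈ m.primeFactors, ((if p < P then K else 1) * ((p ^ m.factorization p : ℕ) : ℝ) ^ ε) :=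
        Finset.prod_le_prod (fun _ _ => by positivity)
          (fun p hp => by have := hfactor p hp; push_cast at this ⊢; exact this)
    _ = (∏ p ∈ m.primeFactors, (if p < P then K else 1)) * (m : ℝ) ^ ε := by
        rw [Finset.prod_mul_distrib, hm']
    _ ≤ K ^ P * (m : ℝ) ^ ε := by
        gcongr
        rw [← Finset.prod_filter, Finset.prod_const]
        refine pow_le_pow_right₀ hK1 ?_
        calc _ ≤ (Finset.range P).card := Finset.card_le_card (fun p hp => by
                simp only [Finset.mem_filter] at hp; simpa using hp.2)
          _ = P := Finset.card_range P

/-- Fix one root `r₀` and sort the roots `r` by `d = gcd(r - r₀, M)`. Since `M ∣ (r - r₀)(r + r₀)`,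
the cofactor `e = M / d` divides `r + r₀`, so `r` is determined modulo `lcm(d, e) = M / gcd(d, e)`,
and `gcd(d, e)` divides `4N`. -/
theorem card_sqrt_neg_mod_le (N M : ℕ) (hN : 0 < N) (hM : 0 < M) :
    ((Finset.range M).filter (fun r => M ∣ r ^ 2 + N)).card ≤ 4 * N * M.divisors.card := by
  set R := (Finset.range M).filter (fun r => M ∣ r ^ 2 + N) with hR
  obtain hemp | ⟨r₀, hr₀⟩ := R.eq_empty_or_nonempty
  · simp [hemp]
  have hr₀' : (M : ℤ) ∣ (r₀ : ℤ) ^ 2 + N := by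
    have := (Finset.mem_filter.mp hr₀).2
    exact_mod_cast this
  set f : ℕ → ℕ := fun r => Int.gcd ((r : ℤ) - r₀) M with hf
  refine (Finset.card_le_mul_card_image_of_maps_to (f := f) (t := M.divisors) ?_ (4 * N) ?_)
  · intro r _
    exact Nat.mem_divisors.mpr ⟨Int.natCast_dvd_natCast.mp (Int.gcd_dvd_right ((r : ℤ) - r₀) M), hM.ne'⟩
  · intro d hd
    obtain ⟨e, hde⟩ := (Nat.mem_divisors.mp hd).1
    have hd0 : 0 < d := Nat.pos_of_mem_divisors hd
    have he0 : 0 < e := Nat.pos_of_ne_zero (by rintro rfl; simp at hde; omega)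
    have hfib : ∀ r ∈ R.filter (fun r => f r = d),
        (d : ℤ) ∣ (r : ℤ) - r₀ ∧ (e : ℤ) ∣ (r : ℤ) + r₀ := by
      intro r hr
      obtain ⟨hr, hrd⟩ := Finset.mem_filter.mp hr
      have hrM : (M : ℤ) ∣ (r : ℤ) ^ 2 + N := by
        have := (Finset.mem_filter.mp hr).2
        exact_mod_cast this
      have hdr : (d : ℤ) ∣ (r : ℤ) - r₀ := by rw [← hrd]; exact Int.gcd_dvd_left _ _
      refine ⟨hdr, ?_⟩
      obtain ⟨s, hs⟩ := hdr
      -- As `d` is the exact gcd, nothing of `e` is left in `s = (r - r₀) / d`.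
      have hcop : IsCoprime (e : ℤ) s := by
        rw [Int.isCoprime_iff_gcd_eq_one]
        have h1 : Int.gcd ((d : ℤ) * s) (d * e) = d := by
          rw [← hs, ← Nat.cast_mul, ← hde]; exact hrd
        rw [Int.gcd_mul_left] at h1
        simp only [Int.natAbs_natCast] at h1
        rw [Int.gcd_comm]
        exact Nat.eq_of_mul_eq_mul_left hd0 (by rw [h1, mul_one])
      have h2 : (M : ℤ) ∣ ((r : ℤ) - r₀) * (r + r₀) := by
        exact dvd_trans (dvd_sub hrM hr₀') (dvd_of_eq (by ring))
      rw [hs, hde] at h2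
      push_cast at h2
      rw [mul_assoc] at h2
      exact hcop.dvd_of_dvd_mul_left (Int.dvd_of_mul_dvd_mul_left (by positivity) h2)
    set g := Nat.gcd d e with hg
    have hgpos : 0 < g := Nat.gcd_pos_of_pos_left _ hd0
    have hlcm : g * Nat.lcm d e = M := by rw [hg, Nat.gcd_mul_lcm, hde]
    obtain hemp | ⟨r₁, hr₁⟩ := (R.filter (fun r => f r = d)).eq_empty_or_nonempty
    · rw [hemp]; simp
    have hgN : g ∣ 4 * N := by
      obtain ⟨h1, h2⟩ := hfib r₁ hr₁
      have hgd : (g : ℤ) ∣ d := by exact_mod_cast Nat.gcd_dvd_left d e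
      have hge : (g : ℤ) ∣ e := by exact_mod_cast Nat.gcd_dvd_right d e
      have h3 : (g : ℤ) ∣ 2 * r₀ := by
        exact dvd_trans (dvd_sub (hge.trans h2) (hgd.trans h1)) (dvd_of_eq (by ring))
      have h4 : (g : ℤ) ∣ (r₀ : ℤ) ^ 2 + N :=
        dvd_trans (dvd_trans hgd (by exact_mod_cast Dvd.intro e hde.symm)) hr₀'
      have h5 : (g : ℤ) ∣ 4 * N := by
        exact dvd_trans (dvd_sub (h4.mul_left 4) (h3.mul_right (2 * r₀))) (dvd_of_eq (by ring))
      exact_mod_cast h5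
    refine le_trans ?_ (Nat.le_of_dvd (by positivity) hgN)
    rw [← Finset.card_range g]
    -- The residue modulo the lcm is common to the fibre, so the quotient, which is below `M / lcm =
    -- g`, determines `r`.
    refine Finset.card_le_card_of_injOn (fun r => r / Nat.lcm d e) ?_ ?_
    · intro r hr
      have hrM := Finset.mem_range.mp (Finset.mem_filter.mp (Finset.mem_filter.mp hr).1).1
      simp only [Finset.coe_range, Set.mem_Iio]
      exact Nat.div_lt_of_lt_mul (by rw [mul_comm, hlcm]; exact hrM)
    · intro r hr s hs hrs
      obtain ⟨a1, a2⟩ := hfib r hr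
      obtain ⟨b1, b2⟩ := hfib s hs
      have h1 : (d : ℤ) ∣ (r : ℤ) - s := by
        exact dvd_trans (dvd_sub a1 b1) (dvd_of_eq (by ring))
      have h2 : (e : ℤ) ∣ (r : ℤ) - s := by
        exact dvd_trans (dvd_sub a2 b2) (dvd_of_eq (by ring))
      have h3 : s ≡ r [MOD Nat.lcm d e] := by
        rw [Nat.modEq_iff_dvd]
        exact Int.natCast_dvd.mpr (Nat.lcm_dvd (Int.natCast_dvd.mp h1) (Int.natCast_dvd.mp h2))
      have h4 : s % Nat.lcm d e = r % Nat.lcm d e := h3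
      rw [← Nat.div_add_mod r (Nat.lcm d e), ← Nat.div_add_mod s (Nat.lcm d e), h4]
      simp only at hrs
      rw [hrs]

/-- The representations of `M` by the form `X² + N Y²`. -/
noncomputable def formReps (N M : ℕ) : Finset (ℤ × ℤ) :=
  (Finset.Icc (-(M : ℤ)) M ×ˢ Finset.Icc (-(M : ℤ)) M).filter
    (fun p => p.1 ^ 2 + N * p.2 ^ 2 = M)

theorem mem_formReps {N M : ℕ} (hN : 0 < N) {p : ℤ × ℤ} :
    p ∈ formReps N M ↔ p.1 ^ 2 + N * p.2 ^ 2 = M := by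
  simp only [formReps, Finset.mem_filter, Finset.mem_product, Finset.mem_Icc, and_iff_right_iff_imp]
  intro h
  have h0 : (1 : ℤ) ≤ N := by exact_mod_cast hN
  have hx : p.1 ^ 2 ≤ M := by nlinarith [sq_nonneg p.2]
  have hy : p.2 ^ 2 ≤ M := by nlinarith [sq_nonneg p.1, sq_nonneg p.2]
  refine ⟨⟨?_, ?_⟩, ?_, ?_⟩ <;> nlinarith [Int.le_self_sq p.1, Int.le_self_sq p.2,
    Int.le_self_sq (-p.1), Int.le_self_sq (-p.2)]

/-- A primitive representation has `y` invertible modulo `M`, so `r = x / y` is a square root of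
`-N` modulo `M`. Two representations with the same `r` generate the same ideal in spirit: `x + y√-N`
and `x₀ + y₀√-N` differ by an element of norm `1` in `ℤ[√-N]`. -/
theorem card_primitive_formReps_le (N M : ℕ) (hN : 0 < N) (hM : 0 < M) :
    ((formReps N M).filter (fun p => IsCoprime p.1 p.2)).card ≤ 36 * N * M.divisors.card := by
  have hM' : (M : ℤ) ≠ 0 := by exact_mod_cast hM.ne'
  have hkey : ∀ p ∈ (formReps N M).filter (fun p => IsCoprime p.1 p.2),
      ∃ r ∈ (Finset.range M).filter (fun r => M ∣ r ^ 2 + N), (M : ℤ) ∣ p.1 - r * p.2 := by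
    rintro ⟨x, y⟩ hp
    obtain ⟨hp, hc⟩ := Finset.mem_filter.mp hp
    rw [mem_formReps hN] at hp
    simp only at hp hc ⊢
    have hyM : IsCoprime y (M : ℤ) := by
      rw [← hp]
      have : IsCoprime y (x ^ 2 + y * (N * y)) := (IsCoprime.add_mul_left_right hc.symm.pow_right _)
      convert this using 1; ring
    obtain ⟨u, v, huv⟩ := hyM
    have hnn := Int.emod_nonneg (x * u) hM'
    have hlt := Int.emod_lt_of_pos (x * u) (by positivity : (0 : ℤ) < M)
    have hdiv := Int.mul_ediv_add_emod (x * u) M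
    set q := (x * u) / (M : ℤ)
    obtain ⟨r, hr⟩ := Int.eq_ofNat_of_zero_le hnn
    rw [hr] at hlt hdiv
    have h1 : (M : ℤ) ∣ x - r * y := ⟨q * y + x * v, by linear_combination (-x) * huv - y * hdiv⟩
    refine ⟨r, ?_, h1⟩
    rw [Finset.mem_filter, Finset.mem_range]
    refine ⟨by exact_mod_cast hlt, ?_⟩
    have h2 : (M : ℤ) ∣ y ^ 2 * ((r : ℤ) ^ 2 + N) := by
      exact dvd_trans (dvd_sub (dvd_refl (M : ℤ)) (h1.mul_right (x + r * y)))
        (dvd_of_eq (by linear_combination -hp))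
    have h3 : IsCoprime (M : ℤ) (y ^ 2) :=
      IsCoprime.pow_right ⟨v, u, by linear_combination huv⟩
    have := h3.dvd_of_dvd_mul_left h2
    exact_mod_cast this
  choose! f hf hfd using hkey
  have hcard := card_sqrt_neg_mod_le N M hN hM
  refine (Finset.card_le_mul_card_image_of_maps_to (f := f) hf 9 ?_).trans (by nlinarith)
  intro r hr
  obtain hemp | ⟨⟨x₀, y₀⟩, hp₀⟩ :=
    (((formReps N M).filter (fun p => IsCoprime p.1 p.2)).filter (fun p => f p = r)).eq_empty_or_nonempty
  · rw [hemp]; simp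
  have hspec : ∀ x y, (x, y) ∈ ((formReps N M).filter (fun p => IsCoprime p.1 p.2)).filter
      (fun p => f p = r) → x ^ 2 + N * y ^ 2 = M ∧ (M : ℤ) ∣ x - r * y := by
    intro x y h
    obtain ⟨h1, h2⟩ := Finset.mem_filter.mp h
    have h3 := hfd _ h1
    rw [h2] at h3
    exact ⟨(mem_formReps hN).mp (Finset.mem_filter.mp h1).1, h3⟩
  obtain ⟨h₀, hd₀⟩ := hspec _ _ hp₀
  have hrN : (M : ℤ) ∣ (r : ℤ) ^ 2 + N := by
    have := (Finset.mem_filter.mp hr).2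
    exact_mod_cast this
  -- The image lists the products `(x₀ + y₀√-N)(u - v√-N)` with `u, v ∈ {-1, 0, 1}`.
  calc _ ≤ ((Finset.Icc (-1 : ℤ) 1 ×ˢ Finset.Icc (-1 : ℤ) 1).image
        (fun w => (x₀ * w.1 + N * y₀ * w.2, y₀ * w.1 - x₀ * w.2))).card := ?_
    _ ≤ _ := Finset.card_image_le
    _ = 9 := by decide
  refine Finset.card_le_card ?_
  rintro ⟨x, y⟩ hp
  obtain ⟨h₁, hd₁⟩ := hspec _ _ hp
  -- The quotient is `(x + y√-N)(x₀ - y₀√-N) / M`; the congruences modulo `M` make both its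
  -- coordinates integral.
  obtain ⟨v, hv⟩ : (M : ℤ) ∣ x * y₀ - x₀ * y := by
    exact dvd_trans (dvd_sub (hd₁.mul_right y₀) (hd₀.mul_right y)) (dvd_of_eq (by ring))
  obtain ⟨u, hu⟩ : (M : ℤ) ∣ x * x₀ + N * y * y₀ := by
    exact dvd_trans (dvd_add (dvd_add (hd₁.mul_right x₀) (hd₀.mul_right (r * y))) (hrN.mul_right (y * y₀))) (dvd_of_eq (by ring))
  have hunit : u ^ 2 + N * v ^ 2 = 1 := by
    have : (M : ℤ) ^ 2 * (u ^ 2 + N * v ^ 2) = M ^ 2 * 1 := by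
      calc (M : ℤ) ^ 2 * (u ^ 2 + N * v ^ 2) = (M * u) ^ 2 + N * (M * v) ^ 2 := by ring
        _ = (x ^ 2 + N * y ^ 2) * (x₀ ^ 2 + N * y₀ ^ 2) := by rw [← hu, ← hv]; ring
        _ = _ := by rw [h₀, h₁]; ring
    exact mul_left_cancel₀ (pow_ne_zero 2 hM') this
  have hN1 : (1 : ℤ) ≤ N := by exact_mod_cast hN
  have hu1 : u ^ 2 ≤ 1 := by nlinarith [sq_nonneg v]
  have hv1 : v ^ 2 ≤ 1 := by nlinarith [sq_nonneg u, sq_nonneg v]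
  rw [Finset.mem_image]
  refine ⟨(u, v), ?_, ?_⟩
  · simp only [Finset.mem_product, Finset.mem_Icc]
    refine ⟨⟨?_, ?_⟩, ?_, ?_⟩ <;> nlinarith
  · simp only [Prod.mk.injEq]
    constructor
    · apply mul_left_cancel₀ hM'
      linear_combination (-x₀) * hu - N * y₀ * hv + x * h₀
    · apply mul_left_cancel₀ hM'
      linear_combination (-y₀) * hu + x₀ * hv + y * h₀

/-- Dividing by `g = gcd(x, y)` leaves a primitive representation of `M / g²`; the second divisor
count is for the choice of `g`. -/
theorem card_formReps_le (N M : ℕ) (hN : 0 < N) (hM : 0 < M) :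
    (formReps N M).card ≤ 36 * N * M.divisors.card ^ 2 := by
  have hsub : formReps N M ⊆ (M.divisors.filter (fun g => g ^ 2 ∣ M)).biUnion (fun g =>
      ((formReps N (M / g ^ 2)).filter (fun p => IsCoprime p.1 p.2)).image
        (fun p => ((g : ℤ) * p.1, (g : ℤ) * p.2))) := by
    rintro ⟨x, y⟩ hp
    rw [mem_formReps hN] at hp
    simp only at hp
    have hg : 0 < Int.gcd x y := by
      rw [Int.gcd_pos_iff]
      by_contra! h
      obtain ⟨rfl, rfl⟩ := h
      simp at hp
      omega
    obtain ⟨x', y', hcop, hx, hy⟩ := Int.exists_gcd_one hg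
    set g := Int.gcd x y
    have hM' : (M : ℤ) = g ^ 2 * (x' ^ 2 + N * y' ^ 2) := by rw [← hp, hx, hy]; ring
    have hgM : g ^ 2 ∣ M := by
      have : (g : ℤ) ^ 2 ∣ M := Dvd.intro _ hM'.symm
      exact_mod_cast this
    rw [Finset.mem_biUnion]
    refine ⟨g, ?_, ?_⟩
    · rw [Finset.mem_filter, Nat.mem_divisors]
      exact ⟨⟨(Dvd.intro_left (g ^ 1) (by ring)).trans hgM, hM.ne'⟩, hgM⟩
    · rw [Finset.mem_image]
      refine ⟨(x', y'), ?_, by rw [hx, hy]; simp [mul_comm]⟩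
      rw [Finset.mem_filter, mem_formReps hN]
      refine ⟨?_, by rwa [Int.isCoprime_iff_gcd_eq_one]⟩
      obtain ⟨k, hk⟩ := hgM
      have : M / g ^ 2 = k := by rw [hk]; exact Nat.mul_div_cancel_left _ (by positivity)
      rw [this]
      rw [hk] at hM'
      push_cast at hM'
      exact (mul_left_cancel₀ (by positivity) hM').symm
  refine (Finset.card_le_card hsub).trans ?_
  refine (Finset.card_biUnion_le_card_mul _ _ (36 * N * M.divisors.card) ?_).trans ?_
  · intro g hg
    obtain ⟨hg1, hg2⟩ := Finset.mem_filter.mp hg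
    have hpos : 0 < M / g ^ 2 := Nat.div_pos (Nat.le_of_dvd hM hg2)
      (by have := Nat.pos_of_mem_divisors hg1; positivity)
    refine Finset.card_image_le.trans ((card_primitive_formReps_le N _ hN hpos).trans ?_)
    gcongr
    exact Nat.div_dvd_of_dvd hg2
  · calc _ ≤ M.divisors.card * (36 * N * M.divisors.card) := by
          gcongr; exact Finset.filter_subset _ _
      _ = _ := by ring

theorem exists_card_formReps_le_rpow (N : ℕ) (hN : 0 < N) (ε : ℝ) (hε : 0 < ε) :
    ∃ C : ℝ, 1 ≤ C ∧ ∀ M : ℕ, 0 < M → ((formReps N M).card : ℝ) ≤ C * (M : ℝ) ^ ε := by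
  obtain ⟨C, hC, h⟩ := Nat.exists_card_divisors_le_rpow (ε / 2) (by positivity)
  have hN1 : (1 : ℝ) ≤ N := by exact_mod_cast hN
  refine ⟨36 * N * C ^ 2, by nlinarith [one_le_pow₀ hC (n := 2)], fun M hM => ?_⟩
  calc ((formReps N M).card : ℝ) ≤ 36 * N * (M.divisors.card : ℝ) ^ 2 := by
        exact_mod_cast card_formReps_le N M hN hM
    _ ≤ 36 * N * (C * (M : ℝ) ^ (ε / 2)) ^ 2 := by gcongr; exact h M hM.ne'
    _ = 36 * N * C ^ 2 * ((M : ℝ) ^ (ε / 2)) ^ 2 := by ring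
    _ = _ := by rw [← Real.rpow_mul_natCast (by positivity)]; norm_num

/-! ### Hyperbolic elements of `SL(2, ℝ)`: diagonalisation, powers and roots. -/

/-- The matrix `diag(l, m)` with `l m = 1` as an element of `SL(2, ℝ)`. -/
def diagSL (l m : ℝ) (h : l * m = 1) : SL(2, ℝ) := ⟨!![l, 0; 0, m], by simp [Matrix.det_fin_two, h]⟩

@[simp]
theorem coe_diagSL (l m : ℝ) (h : l * m = 1) :
    (diagSL l m h : Matrix (Fin 2) (Fin 2) ℝ) = !![l, 0; 0, m] := rfl

theorem diagSL_pow (l m : ℝ) (h : l * m = 1) (j : ℕ) :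
    diagSL l m h ^ j = diagSL (l ^ j) (m ^ j) (by rw [← mul_pow, h, one_pow]) := by
  induction j with
  | zero => ext i k; fin_cases i <;> fin_cases k <;> simp
  | succ j ih =>
    rw [pow_succ, ih]
    ext i k
    fin_cases i <;> fin_cases k <;> simp [Matrix.mul_apply, pow_succ]

theorem SL2_trace_conj (g A : SL(2, ℝ)) :
    ((g * A * g⁻¹ : SL(2, ℝ)) : Matrix (Fin 2) (Fin 2) ℝ).trace =
      (A : Matrix (Fin 2) (Fin 2) ℝ).trace := by
  rw [Matrix.SpecialLinearGroup.coe_mul, Matrix.trace_mul_comm,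
    ← Matrix.SpecialLinearGroup.coe_mul]
  simp

theorem SL2_det_eq (A : SL(2, ℝ)) :
    (A : Matrix (Fin 2) (Fin 2) ℝ) 0 0 * (A : Matrix (Fin 2) (Fin 2) ℝ) 1 1 -
      (A : Matrix (Fin 2) (Fin 2) ℝ) 0 1 * (A : Matrix (Fin 2) (Fin 2) ℝ) 1 0 = 1 := by
  rw [← Matrix.det_fin_two, Matrix.SpecialLinearGroup.det_coe]

theorem exists_conj_diagSL (A : SL(2, ℝ)) (hA : 2 < |(A : Matrix (Fin 2) (Fin 2) ℝ).trace|) :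
    ∃ (g : SL(2, ℝ)) (l m : ℝ) (h : l * m = 1), A = g * diagSL l m h * g⁻¹ := by
  have hdet := SL2_det_eq A
  set a := (A : Matrix (Fin 2) (Fin 2) ℝ) 0 0 with ha
  set b := (A : Matrix (Fin 2) (Fin 2) ℝ) 0 1 with hb
  set c := (A : Matrix (Fin 2) (Fin 2) ℝ) 1 0 with hc
  set d := (A : Matrix (Fin 2) (Fin 2) ℝ) 1 1 with hd
  have htr : (A : Matrix (Fin 2) (Fin 2) ℝ).trace = a + d := by rw [Matrix.trace_fin_two]
  rw [htr] at hA
  have hdisc : 0 < (a + d) ^ 2 - 4 := by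
    have : (2 : ℝ) ^ 2 < |a + d| ^ 2 := by gcongr
    rw [sq_abs] at this
    linarith
  -- The columns `(p, r)` and `(q, s)` of the conjugating matrix are eigenvectors for `l` and `m`.
  suffices H : ∃ (p q r s l m : ℝ), p * s - q * r = 1 ∧ l * m = 1 ∧
      a * p + b * r = l * p ∧ c * p + d * r = l * r ∧
      a * q + b * s = m * q ∧ c * q + d * s = m * s by
    obtain ⟨p, q, r, s, l, m, h1, h2, h3, h4, h5, h6⟩ := H
    obtain ⟨g, hg⟩ : ∃ g : SL(2, ℝ), (g : Matrix (Fin 2) (Fin 2) ℝ) = !![p, q; r, s] :=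
      ⟨⟨!![p, q; r, s], by rw [Matrix.det_fin_two]; simpa using h1⟩, rfl⟩
    refine ⟨g, l, m, h2, ?_⟩
    rw [eq_mul_inv_iff_mul_eq]
    ext i k
    fin_cases i <;> fin_cases k <;>
      simp [hg, Matrix.mul_apply, ← ha, ← hb, ← hc, ← hd] <;> linarith
  by_cases hc0 : c = 0
  · rw [hc0, mul_zero, sub_zero] at hdet
    have hne : d - a ≠ 0 := by
      intro h
      have : (d - a) ^ 2 = (a + d) ^ 2 - 4 := by linear_combination (-4) * hdet
      rw [h] at this; linarith
    refine ⟨1, b / (d - a), 0, 1, a, d, by ring, hdet, by ring, by rw [hc0]; ring, ?_,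
      by rw [hc0]; ring⟩
    field_simp; ring
  · set w := √((a + d) ^ 2 - 4) with hw
    have hw2 : w ^ 2 = (a + d) ^ 2 - 4 := Real.sq_sqrt hdisc.le
    have hw0 : w ≠ 0 := (Real.sqrt_pos.mpr hdisc).ne'
    -- The eigenvectors are `((a - d ± w) / 2, c)`; the second is divided by `c w` to make the
    -- determinant `1`.
    refine ⟨(a - d + w) / 2, (a - d - w) / 2 / (c * w), c, c / (c * w),
      (a + d + w) / 2, (a + d - w) / 2, ?_, ?_, ?_, ?_, ?_, ?_⟩
    · field_simp; ring
    · linear_combination (-1 / 4) * hw2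
    · linear_combination (-1 / 4) * hw2 - hdet
    · ring
    · field_simp; linear_combination - hw2 - 4 * hdet
    · field_simp; ring

theorem diagSL_trace_abs {l m : ℝ} (h : l * m = 1) :
    |(diagSL l m h : Matrix (Fin 2) (Fin 2) ℝ).trace| = |l| + |m| := by
  have : (diagSL l m h : Matrix (Fin 2) (Fin 2) ℝ).trace = l + m := by
    simp [Matrix.trace_fin_two]
  rw [this, abs_add_eq_add_abs_iff]
  rcases lt_trichotomy l 0 with hl | hl | hl
  · right; exact ⟨hl.le, by nlinarith⟩
  · simp [hl] at h
  · left; exact ⟨hl.le, by nlinarith⟩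

/-- Eigenvalues with `|l||m| = 1` and `|l| + |m| ≥ 3` cannot both be below `2` in absolute value. -/
theorem two_pow_le_abs_trace_pow (A : SL(2, ℝ))
    (hA : 3 ≤ |(A : Matrix (Fin 2) (Fin 2) ℝ).trace|) (j : ℕ) :
    (2 : ℝ) ^ j ≤ |((A ^ j : SL(2, ℝ)) : Matrix (Fin 2) (Fin 2) ℝ).trace| := by
  obtain ⟨g, l, m, h, rfl⟩ := exists_conj_diagSL A (by linarith)
  rw [conj_pow, SL2_trace_conj, diagSL_pow, diagSL_trace_abs, abs_pow, abs_pow]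
  rw [SL2_trace_conj, diagSL_trace_abs] at hA
  have hlm : |l| * |m| = 1 := by rw [← abs_mul, h, abs_one]
  have : 2 ≤ |l| ∨ 2 ≤ |m| := by
    by_contra! hcon
    nlinarith [hcon.1, hcon.2]
  rcases this with h2 | h2
  · have := pow_le_pow_left₀ (by norm_num) h2 j
    have : 0 ≤ |m| ^ j := by positivity
    linarith
  · have := pow_le_pow_left₀ (by norm_num) h2 j
    have : 0 ≤ |l| ^ j := by positivity
    linarith

/-- In an eigenbasis of `A`, the power `A ^ j` is diagonal with distinct entries. The root `B`
commutes with it, hence is diagonal too, and real `j`-th roots are unique up to sign. -/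
theorem eq_or_eq_neg_of_pow_eq {A B : SL(2, ℝ)}
    (hA : 2 < |(A : Matrix (Fin 2) (Fin 2) ℝ).trace|) {j : ℕ} (hj : 1 ≤ j)
    (h : A ^ j = B ^ j) : B = A ∨ B = -A := by
  obtain ⟨g, l, m, hlm, rfl⟩ := exists_conj_diagSL A hA
  rw [SL2_trace_conj, diagSL_trace_abs] at hA
  obtain ⟨E, rfl⟩ : ∃ E, B = g * E * g⁻¹ := ⟨g⁻¹ * B * g, by group⟩
  rw [conj_pow, conj_pow, diagSL_pow] at h
  have hE : diagSL (l ^ j) (m ^ j) (by rw [← mul_pow, hlm, one_pow]) = E ^ j :=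
    mul_left_cancel (mul_right_cancel h)
  have hj0 : j ≠ 0 := by omega
  have hne : l ^ j ≠ m ^ j := by
    intro hlj
    have habs : |l| = |m| := by
      rw [← pow_left_inj₀ (abs_nonneg l) (abs_nonneg m) hj0, ← abs_pow, ← abs_pow, hlj]
    have hlm' : |l| * |m| = 1 := by rw [← abs_mul, hlm, abs_one]
    rw [habs] at hA hlm'
    nlinarith [abs_nonneg m]
  have hcomm : E * diagSL (l ^ j) (m ^ j) (by rw [← mul_pow, hlm, one_pow]) =
      diagSL (l ^ j) (m ^ j) (by rw [← mul_pow, hlm, one_pow]) * E := by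
    rw [hE]; exact (Commute.refl E).pow_right j
  have hcomm' := congrArg (fun X : SL(2, ℝ) => (X : Matrix (Fin 2) (Fin 2) ℝ)) hcomm
  have h01 := congrFun (congrFun hcomm' 0) 1
  have h10 := congrFun (congrFun hcomm' 1) 0
  simp [Matrix.mul_apply] at h01 h10
  have e01 : (E : Matrix (Fin 2) (Fin 2) ℝ) 0 1 = 0 := by
    have : (E : Matrix (Fin 2) (Fin 2) ℝ) 0 1 * (m ^ j - l ^ j) = 0 := by linarith
    exact (mul_eq_zero.mp this).resolve_right (sub_ne_zero.mpr hne.symm)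
  have e10 : (E : Matrix (Fin 2) (Fin 2) ℝ) 1 0 = 0 := by
    have : (E : Matrix (Fin 2) (Fin 2) ℝ) 1 0 * (l ^ j - m ^ j) = 0 := by linarith
    exact (mul_eq_zero.mp this).resolve_right (sub_ne_zero.mpr hne)
  have hEdet := SL2_det_eq E
  rw [e01, zero_mul, sub_zero] at hEdet
  set x := (E : Matrix (Fin 2) (Fin 2) ℝ) 0 0 with hx
  set y := (E : Matrix (Fin 2) (Fin 2) ℝ) 1 1 with hy
  have hEd : E = diagSL x y hEdet := by
    ext i k
    fin_cases i <;> fin_cases k <;> simp [e01, e10, hx, hy]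
  rw [hEd, diagSL_pow] at hE
  have hE' := congrArg (fun X : SL(2, ℝ) => (X : Matrix (Fin 2) (Fin 2) ℝ) 0 0) hE
  simp at hE'
  have hxl : |x| = |l| := by
    rw [← pow_left_inj₀ (abs_nonneg x) (abs_nonneg l) hj0, ← abs_pow, ← abs_pow, hE']
  have hl0 : l ≠ 0 := left_ne_zero_of_mul_eq_one hlm
  rcases abs_eq_abs.mp hxl with hxl | hxl
  · left
    have hym : y = m := by
      rw [hxl] at hEdet
      exact mul_left_cancel₀ hl0 (hEdet.trans hlm.symm)
    rw [hEd]
    simp only [hxl, hym]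
  · right
    have hym : y = -m := by
      rw [hxl] at hEdet
      refine mul_left_cancel₀ hl0 ?_
      linarith
    have : diagSL x y hEdet = -diagSL l m hlm := by
      ext i k
      fin_cases i <;> fin_cases k <;> simp [hxl, hym]
    rw [hEd, this]
    simp

/-- The difference of the off-diagonal entries equals `(pq + rs)(m - l)`. For `quatMatrix q` this
same difference is `2√(ab) q₃`, so the estimate will bound `q₃`. -/
theorem abs_sub_conj_diagSL_le (h : SL(2, ℝ)) {R l m : ℝ}
    (hR : ∀ i k, |(h : Matrix (Fin 2) (Fin 2) ℝ) i k| ≤ R) (hlm : l * m = 1) :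
    |((h * diagSL l m hlm * h⁻¹ : SL(2, ℝ)) : Matrix (Fin 2) (Fin 2) ℝ) 0 1 -
      ((h * diagSL l m hlm * h⁻¹ : SL(2, ℝ)) : Matrix (Fin 2) (Fin 2) ℝ) 1 0| ≤
      2 * R ^ 2 * (|l| + |m|) := by
  set p := (h : Matrix (Fin 2) (Fin 2) ℝ) 0 0 with hp
  set q := (h : Matrix (Fin 2) (Fin 2) ℝ) 0 1 with hq
  set r := (h : Matrix (Fin 2) (Fin 2) ℝ) 1 0 with hr
  set s := (h : Matrix (Fin 2) (Fin 2) ℝ) 1 1 with hs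
  have hR0 : 0 ≤ R := (abs_nonneg _).trans (hR 0 0)
  have heq : ((h * diagSL l m hlm * h⁻¹ : SL(2, ℝ)) : Matrix (Fin 2) (Fin 2) ℝ) 0 1 -
      ((h * diagSL l m hlm * h⁻¹ : SL(2, ℝ)) : Matrix (Fin 2) (Fin 2) ℝ) 1 0 =
      (p * q + r * s) * (m - l) := by
    simp [Matrix.mul_apply, Matrix.adjugate_fin_two, ← hp, ← hq, ← hr, ← hs]
    ring
  rw [heq, abs_mul]
  have h1 : |p * q + r * s| ≤ 2 * R ^ 2 := by
    calc |p * q + r * s| ≤ |p * q| + |r * s| := abs_add_le _ _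
      _ = |p| * |q| + |r| * |s| := by rw [abs_mul, abs_mul]
      _ ≤ R * R + R * R := by gcongr <;> exact hR _ _
      _ = _ := by ring
  have h2 : |m - l| ≤ |l| + |m| := by rw [add_comm]; exact abs_sub _ _
  gcongr

/-! ### From covers of conjugacy classes to the trace multiplicity. -/

/-- Every element of `Γ` whose trace is `n` in absolute value is conjugate in `Γ` to an element
of `S`. -/
def ConjCover (Γ : Subgroup SL(2, ℝ)) (n : ℕ) (S : Finset (Matrix (Fin 2) (Fin 2) ℝ)) : Prop :=
  ∀ A ∈ Γ, |(A : Matrix (Fin 2) (Fin 2) ℝ).trace| = n →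
    ∃ v ∈ Γ, ((v * A * v⁻¹ : SL(2, ℝ)) : Matrix (Fin 2) (Fin 2) ℝ) ∈ S

/-- There are at most `C n ^ (1 + ε)` conjugacy classes of trace `± n` in `Γ`, for `n ≥ 3`. -/
def HasSmallConjCovers (Γ : Subgroup SL(2, ℝ)) : Prop :=
  ∀ ε : ℝ, 0 < ε → ∃ C : ℝ, 0 < C ∧ ∀ n : ℕ, 3 ≤ n →
    ∃ S : Finset (Matrix (Fin 2) (Fin 2) ℝ), (S.card : ℝ) ≤ C * (n : ℝ) ^ (1 + ε) ∧ ConjCover Γ n S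

/-- If `u ∈ G` conjugates `A` into `S` and `t` represents the coset `uΓ`, then `t⁻¹u ∈ Γ` conjugates
`A` into `t⁻¹St`. The union over the finitely many `t` multiplies the size by at most the index. -/
theorem HasSmallConjCovers.of_relIndex_ne_zero {G Γ : Subgroup SL(2, ℝ)}
    (hG : HasSmallConjCovers G) (hΓ : Γ ≤ G) (hfin : Γ.relIndex G ≠ 0) :
    HasSmallConjCovers Γ := by
  classical
  intro ε hε
  obtain ⟨C, hC, h⟩ := hG ε hε
  have : (Γ.subgroupOf G).FiniteIndex := ⟨hfin⟩
  have : Fintype (G ⧸ Γ.subgroupOf G) := Fintype.ofFinite _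
  set k := Fintype.card (G ⧸ Γ.subgroupOf G) with hk
  have hk0 : 0 < k := Fintype.card_pos
  refine ⟨k * C, by positivity, fun n hn => ?_⟩
  obtain ⟨S, hS, hcov⟩ := h n hn
  refine ⟨Finset.univ.biUnion (fun q : G ⧸ Γ.subgroupOf G =>
    S.image (fun X => ((q.out : SL(2, ℝ))⁻¹ : SL(2, ℝ)).1 * X * (q.out : SL(2, ℝ)).1)), ?_, ?_⟩
  · have : (Finset.univ.biUnion (fun q : G ⧸ Γ.subgroupOf G =>
        S.image (fun X => ((q.out : SL(2, ℝ))⁻¹ : SL(2, ℝ)).1 * X * (q.out : SL(2, ℝ)).1))).card ≤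
        k * S.card :=
      Finset.card_biUnion_le_card_mul _ _ _ (fun q _ => Finset.card_image_le)
    calc _ ≤ ((k * S.card : ℕ) : ℝ) := by exact_mod_cast this
      _ ≤ k * (C * (n : ℝ) ^ (1 + ε)) := by push_cast; gcongr
      _ = _ := by ring
  · intro A hA htr
    obtain ⟨u, hu, huS⟩ := hcov A (hΓ hA) htr
    set q : G ⧸ Γ.subgroupOf G := QuotientGroup.mk ⟨u, hu⟩ with hq
    have hmem : (q.out : SL(2, ℝ))⁻¹ * u ∈ Γ := by
      have : (q.out)⁻¹ * ⟨u, hu⟩ ∈ Γ.subgroupOf G := by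
        rw [← QuotientGroup.eq, QuotientGroup.out_eq']
      simpa [Subgroup.mem_subgroupOf] using this
    refine ⟨_, hmem, ?_⟩
    rw [Finset.mem_biUnion]
    refine ⟨q, Finset.mem_univ _, Finset.mem_image.mpr ⟨_, huS, ?_⟩⟩
    rw [← Matrix.SpecialLinearGroup.coe_mul, ← Matrix.SpecialLinearGroup.coe_mul]
    simp only [_root_.mul_inv_rev, inv_inv, mul_assoc]

theorem mk_neg_eq (B : SL(2, ℝ)) :
    QuotientGroup.mk' (Subgroup.center SL(2, ℝ)) (-B) =
      QuotientGroup.mk' (Subgroup.center SL(2, ℝ)) B := by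
  rw [QuotientGroup.mk'_apply, QuotientGroup.mk'_apply, QuotientGroup.eq]
  rw [Matrix.SpecialLinearGroup.mem_center_iff]
  refine ⟨-1, by simp, ?_⟩
  have : (-B)⁻¹ * B = -1 := by
    rw [inv_mul_eq_iff_eq_mul]; simp
  rw [this]
  ext i k
  fin_cases i <;> fin_cases k <;> simp

/-- Each pair `(γ, j)` is sent to `(B ^ j, j)`, where `B` lifts a representative of the class `γ`
chosen so that `B ^ j ∈ S`. The map is injective by uniqueness of roots up to sign, the sign being
invisible in `PSL(2, ℝ)`; each weight `1 / j` is at most `1`. -/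
theorem traceMult_le_card_mul_log {Γ : Subgroup SL(2, ℝ)}
    (hint : ∀ A ∈ Γ, ∃ z : ℤ, (A : Matrix (Fin 2) (Fin 2) ℝ).trace = z) {n : ℕ}
    {S : Finset (Matrix (Fin 2) (Fin 2) ℝ)} (hS : ConjCover Γ n S) :
    traceMult Γ n ≤ ((S.card * Nat.log 2 n : ℕ) : ℝ≥0∞) := by
  set P := {p : ConjClasses (projImage Γ) × ℕ //
      p.1 ∈ Prim Γ ∧ 1 ≤ p.2 ∧ powTrace p.1 p.2 = n} with hP
  have hdata : ∀ p : P, ∃ B : SL(2, ℝ), ∃ hB : B ∈ Γ,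
      ConjClasses.mk (⟨QuotientGroup.mk' (Subgroup.center SL(2, ℝ)) B,
        Subgroup.mem_map_of_mem _ hB⟩ : projImage Γ) = p.1.1 ∧
      2 < |(B : Matrix (Fin 2) (Fin 2) ℝ).trace| ∧
      ((B ^ p.1.2 : SL(2, ℝ)) : Matrix (Fin 2) (Fin 2) ℝ) ∈ S ∧ p.1.2 ∈ Finset.Icc 1 (Nat.log 2 n) := by
    rintro ⟨⟨c, j⟩, hc, hj, htr⟩
    obtain ⟨⟨γ, hγ⟩, hγc, hγp⟩ := id hc
    simp only at hγc hj htr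
    subst hγc
    obtain ⟨A, hA, rfl⟩ := hγ
    simp only
    have hA2 : 2 < |(A : Matrix (Fin 2) (Fin 2) ℝ).trace| := hγp.1
    have htr' : |((A ^ j : SL(2, ℝ)) : Matrix (Fin 2) (Fin 2) ℝ).trace| = n := htr
    obtain ⟨v, hv, hvS⟩ := hS (A ^ j) (Γ.pow_mem hA j) htr'
    refine ⟨v * A * v⁻¹, Γ.mul_mem (Γ.mul_mem hv hA) (Γ.inv_mem hv), ?_, ?_, ?_, ?_⟩
    · rw [ConjClasses.mk_eq_mk_iff_isConj, isConj_comm, isConj_iff]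
      exact ⟨⟨_, Subgroup.mem_map_of_mem _ hv⟩, by ext; simp⟩
    · rwa [SL2_trace_conj]
    · rwa [conj_pow]
    · have hA3 : 3 ≤ |(A : Matrix (Fin 2) (Fin 2) ℝ).trace| := by
        obtain ⟨z, hz⟩ := hint A hA
        rw [hz] at hA2 ⊢
        have : 2 < |z| := by exact_mod_cast hA2
        exact_mod_cast this
      have h2 := two_pow_le_abs_trace_pow A hA3 j
      rw [htr'] at h2
      have h2' : 2 ^ j ≤ n := by exact_mod_cast h2
      exact Finset.mem_Icc.mpr ⟨hj, Nat.le_log_of_pow_le (by norm_num) h2'⟩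
  choose B hBΓ hBc hB2 hBS hBj using hdata
  have hinj : Function.Injective
      (fun p : P => ((⟨_, hBS p⟩, ⟨_, hBj p⟩) : S × Finset.Icc 1 (Nat.log 2 n))) := by
    intro p p' hpp'
    simp only [Prod.mk.injEq, Subtype.mk.injEq] at hpp'
    obtain ⟨h1, h2⟩ := hpp'
    have h3 : B p ^ p.1.2 = B p' ^ p.1.2 := by
      rw [h2] at h1 ⊢
      exact Subtype.ext h1
    have h4 : QuotientGroup.mk' (Subgroup.center SL(2, ℝ)) (B p) =
        QuotientGroup.mk' (Subgroup.center SL(2, ℝ)) (B p') := by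
      rcases eq_or_eq_neg_of_pow_eq (hB2 p) p.2.2.1 h3 with h | h
      · rw [h]
      · rw [h, mk_neg_eq]
    refine Subtype.ext (Prod.ext ?_ h2)
    rw [← hBc p, ← hBc p']
    congr 1
    exact Subtype.ext h4
  have : Finite P := Finite.of_injective _ hinj
  have : Fintype P := Fintype.ofFinite P
  have hcard := Fintype.card_le_of_injective _ hinj
  rw [Fintype.card_prod, Fintype.card_coe, Fintype.card_coe, Nat.card_Icc, Nat.add_sub_cancel] at hcard
  calc traceMult Γ n = ∑ p : P, ((p.1.2 : ℝ≥0∞))⁻¹ := tsum_fintype _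
    _ ≤ ∑ _p : P, 1 := Finset.sum_le_sum (fun p _ => by
        rw [ENNReal.inv_le_one]; exact_mod_cast p.2.2.1)
    _ = (Fintype.card P : ℝ≥0∞) := by simp
    _ ≤ _ := by exact_mod_cast hcard

theorem traceMult_eq_zero_of_le_two {Γ : Subgroup SL(2, ℝ)} {n : ℕ} (hn : n ≤ 2)
    (hint : ∀ A ∈ Γ, ∃ z : ℤ, (A : Matrix (Fin 2) (Fin 2) ℝ).trace = z) :
    traceMult Γ n = 0 := by
  have : IsEmpty {p : ConjClasses (projImage Γ) × ℕ //
      p.1 ∈ Prim Γ ∧ 1 ≤ p.2 ∧ powTrace p.1 p.2 = n} := by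
    refine ⟨?_⟩
    rintro ⟨⟨c, j⟩, hc, hj, htr⟩
    obtain ⟨⟨γ, hγ⟩, hγc, hγp⟩ := id hc
    simp only at hγc hj htr
    subst hγc
    obtain ⟨A, hA, rfl⟩ := hγ
    have hA2 : 2 < |(A : Matrix (Fin 2) (Fin 2) ℝ).trace| := hγp.1
    have htr' : |((A ^ j : SL(2, ℝ)) : Matrix (Fin 2) (Fin 2) ℝ).trace| = n := htr
    have hA3 : 3 ≤ |(A : Matrix (Fin 2) (Fin 2) ℝ).trace| := by
      obtain ⟨z, hz⟩ := hint A hA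
      rw [hz] at hA2 ⊢
      have : 2 < |z| := by exact_mod_cast hA2
      exact_mod_cast this
    have h2 := two_pow_le_abs_trace_pow A hA3 j
    rw [htr'] at h2
    have h2' : 2 ^ j ≤ n := by exact_mod_cast h2
    have hj1 : j = 1 := by
      by_contra hne
      have : 2 ^ 2 ≤ 2 ^ j := Nat.pow_le_pow_right (by norm_num) (by omega)
      omega
    rw [hj1, pow_one] at htr'
    rw [htr'] at hA2
    have : 2 < n := by exact_mod_cast hA2
    omega
  exact tsum_empty

theorem HasSmallConjCovers.traceMult_le {Γ : Subgroup SL(2, ℝ)} (hΓ : HasSmallConjCovers Γ)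
    (hint : ∀ A ∈ Γ, ∃ z : ℤ, (A : Matrix (Fin 2) (Fin 2) ℝ).trace = z) (ε : ℝ) (hε : 0 < ε) :
    ∃ C : ℝ, 0 < C ∧ ∀ n : ℕ, 1 ≤ n →
      traceMult Γ n ≤ ENNReal.ofReal (C * (n : ℝ) ^ (1 + ε)) := by
  -- The other `ε / 2` absorbs the factor `log₂ n`.
  obtain ⟨C, hC, h⟩ := hΓ (ε / 2) (by positivity)
  have hl2 : 0 < Real.log 2 := Real.log_pos one_lt_two
  refine ⟨C * (1 / Real.log 2 * (2 / ε)), by positivity, fun n hn => ?_⟩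
  rcases Nat.lt_or_ge n 3 with h3 | h3
  · rw [traceMult_eq_zero_of_le_two (by omega) hint]; exact zero_le
  obtain ⟨S, hS, hcov⟩ := h n h3
  refine (traceMult_le_card_mul_log hint hcov).trans ?_
  rw [← ENNReal.ofReal_natCast]
  refine ENNReal.ofReal_le_ofReal ?_
  have hn0 : (0 : ℝ) < n := by exact_mod_cast hn
  have hlog : (Nat.log 2 n : ℝ) ≤ 1 / Real.log 2 * ((n : ℝ) ^ (ε / 2) / (ε / 2)) := by
    have h1 : ((2 ^ Nat.log 2 n : ℕ) : ℝ) ≤ n := by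
      exact_mod_cast Nat.pow_log_le_self 2 (by omega)
    have h2 := Real.log_le_log (by positivity) h1
    push_cast at h2
    rw [Real.log_pow] at h2
    have h3 := Real.log_le_rpow_div hn0.le (show 0 < ε / 2 by positivity)
    rw [one_div, ← div_eq_inv_mul, le_div_iff₀ hl2]
    linarith
  have hpow : (n : ℝ) ^ (1 + ε / 2) * (n : ℝ) ^ (ε / 2) = (n : ℝ) ^ (1 + ε) := by
    rw [← Real.rpow_add hn0]; congr 1; ring
  push_cast
  calc (S.card : ℝ) * (Nat.log 2 n : ℝ) ≤ (C * (n : ℝ) ^ (1 + ε / 2)) *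
        (1 / Real.log 2 * ((n : ℝ) ^ (ε / 2) / (ε / 2))) := by gcongr
    _ = C * (1 / Real.log 2 * (2 / ε)) * ((n : ℝ) ^ (1 + ε / 2) * (n : ℝ) ^ (ε / 2)) := by
        field_simp
    _ = _ := by rw [hpow]

/-! ### The modular group. -/

/-- Gauss reduction: take a conjugate with `|c|` minimal, then translate to get `|a - d| ≤ |c|`. If
`bc ≤ 0`, minimality makes the discriminant `(a - d)² + 4bc` at most `c² - 4c²`, contradicting its
positivity. -/
theorem exists_conj_reduced (A : SL(2, ℤ)) (hA : 3 ≤ |(A : Matrix (Fin 2) (Fin 2) ℤ).trace|) :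
    ∃ V : SL(2, ℤ), ∃ a b c d : ℤ,
      ((V * A * V⁻¹ : SL(2, ℤ)) : Matrix (Fin 2) (Fin 2) ℤ) = !![a, b; c, d] ∧ 0 < b * c := by
  set f : SL(2, ℤ) → ℕ :=
    fun V => (((V * A * V⁻¹ : SL(2, ℤ)) : Matrix (Fin 2) (Fin 2) ℤ) 1 0).natAbs with hf
  obtain ⟨_, ⟨V, rfl⟩, hmin⟩ :=
    (wellFounded_lt (α := ℕ)).has_min (Set.range f) (Set.range_nonempty f)
  have hmin' : ∀ W, f V ≤ f W := fun W => not_lt.mp (hmin _ ⟨W, rfl⟩)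
  have htr : ∀ W : SL(2, ℤ), ((W * A * W⁻¹ : SL(2, ℤ)) : Matrix (Fin 2) (Fin 2) ℤ).trace =
      (A : Matrix (Fin 2) (Fin 2) ℤ).trace := by
    intro W
    rw [Matrix.SpecialLinearGroup.coe_mul, Matrix.trace_mul_comm,
      ← Matrix.SpecialLinearGroup.coe_mul]
    simp
  obtain ⟨B, hB⟩ : ∃ B : SL(2, ℤ), B = V * A * V⁻¹ := ⟨_, rfl⟩
  have hBtr := htr V
  have hBdet := B.det_coe
  rw [← hB, Matrix.trace_fin_two] at hBtr
  rw [Matrix.det_fin_two] at hBdet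
  have hfV : f V = ((B : Matrix (Fin 2) (Fin 2) ℤ) 1 0).natAbs := by rw [hB]
  set a := (B : Matrix (Fin 2) (Fin 2) ℤ) 0 0 with ha
  set b := (B : Matrix (Fin 2) (Fin 2) ℤ) 0 1 with hb
  set c := (B : Matrix (Fin 2) (Fin 2) ℤ) 1 0 with hc
  set d := (B : Matrix (Fin 2) (Fin 2) ℤ) 1 1 with hd
  rw [← hBtr] at hA
  have hD : 9 ≤ (a + d) ^ 2 := by rw [← sq_abs]; nlinarith
  have hc0 : c ≠ 0 := by
    intro h0
    rw [h0, mul_zero, sub_zero] at hBdet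
    rcases Int.eq_one_or_neg_one_of_mul_eq_one' hBdet with ⟨h1, h2⟩ | ⟨h1, h2⟩ <;>
      rw [h1, h2] at hD <;> norm_num at hD
  have hdiv := Int.mul_ediv_add_emod (a - d + |c|) (2 * c)
  have hr0 := Int.emod_nonneg (a - d + |c|) (by omega : 2 * c ≠ 0)
  have hr1 := Int.emod_lt_abs (a - d + |c|) (by omega : 2 * c ≠ 0)
  set r := (a - d + |c|) % (2 * c)
  set k := -((a - d + |c|) / (2 * c)) with hk
  rw [abs_mul, abs_two] at hr1
  obtain ⟨T, hT⟩ : ∃ T : SL(2, ℤ), (T : Matrix (Fin 2) (Fin 2) ℤ) = !![1, k; 0, 1] :=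
    ⟨⟨!![1, k; 0, 1], by simp [Matrix.det_fin_two]⟩, rfl⟩
  obtain ⟨W, hW⟩ : ∃ W : SL(2, ℤ), (W : Matrix (Fin 2) (Fin 2) ℤ) = !![0, -1; 1, 0] :=
    ⟨⟨!![0, -1; 1, 0], by simp [Matrix.det_fin_two]⟩, rfl⟩
  have hTV : (((T * V) * A * (T * V)⁻¹ : SL(2, ℤ)) : Matrix (Fin 2) (Fin 2) ℤ) =
      !![a + k * c, b + k * d - k * (a + k * c); c, d - k * c] := by
    have : (T * V) * A * (T * V)⁻¹ = T * B * T⁻¹ := by rw [hB]; group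
    have hBm : (B : Matrix (Fin 2) (Fin 2) ℤ) = !![a, b; c, d] := Matrix.eta_fin_two _
    rw [this]
    ext i j
    fin_cases i <;> fin_cases j <;>
      simp [hT, hBm, Matrix.adjugate_fin_two] <;> ring
  refine ⟨T * V, _, _, _, _, hTV, ?_⟩
  set b' := b + k * d - k * (a + k * c) with hb'
  -- Conjugation by `W` moves `-b'` into the lower left corner, so minimality of `|c|` applies.
  have hcb : |c| ≤ |b'| := by
    have h1 := hmin' (W * (T * V))
    have h2 : f (W * (T * V)) = b'.natAbs := by
      have : (W * (T * V)) * A * (W * (T * V))⁻¹ = W * ((T * V) * A * (T * V)⁻¹) * W⁻¹ := by group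
      rw [hf]
      simp only
      rw [this, Matrix.SpecialLinearGroup.coe_mul, Matrix.SpecialLinearGroup.coe_mul, hTV]
      simp [hW, Matrix.adjugate_fin_two]
    rw [h2, hfV] at h1
    rw [Int.abs_eq_natAbs, Int.abs_eq_natAbs]
    exact_mod_cast h1
  have he : |a - d + 2 * k * c| ≤ |c| := by
    have : a - d + 2 * k * c = r - |c| := by rw [hk]; linear_combination -hdiv
    rw [this, abs_le]
    constructor <;> linarith
  have hdisc : (a + d) ^ 2 - 4 = (a - d + 2 * k * c) ^ 2 + 4 * (b' * c) := by
    rw [hb']; linear_combination 4 * hBdet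
  by_contra hneg
  have h1 : |b' * c| = -(b' * c) := abs_of_nonpos (not_lt.mp hneg)
  have h2 : |c| * |c| ≤ |b' * c| := by rw [abs_mul]; gcongr
  have h3 : (a - d + 2 * k * c) ^ 2 ≤ |c| ^ 2 := by rw [← sq_abs]; gcongr
  nlinarith

theorem hasSmallConjCovers_modularGroupReal : HasSmallConjCovers modularGroupReal := by
  classical
  intro ε hε
  obtain ⟨C, hC, hdiv⟩ := Nat.exists_card_divisors_le_rpow (ε / 2) (by positivity)
  refine ⟨12 * C, by positivity, fun n hn => ?_⟩
  -- For a reduced matrix of trace `± n` with `e = a - d`, this is `bc`. In `F` below, `t = a + d`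
  -- and `c = s δ` with a sign `s`.
  set M : ℤ → ℕ := fun e => (((n : ℤ) ^ 2 - 4 - e ^ 2) / 4).toNat with hM
  have hn0 : (0 : ℝ) < n := by exact_mod_cast (by omega : 0 < n)
  set F : ℝ → ℤ → ℝ → ℕ → Matrix (Fin 2) (Fin 2) ℝ := fun t e s δ =>
    !![(t + e) / 2, M e / (s * δ); s * δ, (t - e) / 2] with hF
  refine ⟨(Finset.Icc (-(n : ℤ)) n).biUnion (fun e =>
    (({(n : ℝ), -(n : ℝ)} : Finset ℝ) ×ˢ (({1, -1} : Finset ℝ) ×ˢ (M e).divisors)).image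
      (fun p => F p.1 e p.2.1 p.2.2)), ?_, ?_⟩
  · set K : ℝ := C * (n : ℝ) ^ ε with hK
    have hMn : ∀ e, (((M e).divisors.card : ℕ) : ℝ) ≤ K := by
      intro e
      rcases eq_or_ne (M e) 0 with h0 | h0
      · rw [h0]; simp only [Nat.divisors_zero, Finset.card_empty, Nat.cast_zero]; positivity
      have hle : M e ≤ n ^ 2 := by
        have : ((n : ℤ) ^ 2 - 4 - e ^ 2) / 4 ≤ n ^ 2 := by
          have := sq_nonneg e
          have := sq_nonneg (n : ℤ)
          omega
        rw [hM]
        simp only [Int.toNat_le]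
        exact_mod_cast this
      calc (((M e).divisors.card : ℕ) : ℝ) ≤ C * (M e : ℝ) ^ (ε / 2) := hdiv _ h0
        _ ≤ C * ((n : ℝ) ^ 2) ^ (ε / 2) := by gcongr; exact_mod_cast hle
        _ = K := by
            rw [hK, ← Real.rpow_natCast, ← Real.rpow_mul hn0.le]; congr 2; push_cast; ring
    have hcard : ∀ e, ((((({(n : ℝ), -(n : ℝ)} : Finset ℝ) ×ˢ (({1, -1} : Finset ℝ) ×ˢ
        (M e).divisors)).image (fun p => F p.1 e p.2.1 p.2.2)).card : ℕ) : ℝ) ≤ 4 * K := by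
      intro e
      have h1 : (({(n : ℝ), -(n : ℝ)} : Finset ℝ)).card ≤ 2 := Finset.card_le_two
      have h2 : (({1, -1} : Finset ℝ)).card ≤ 2 := Finset.card_le_two
      have h3 : ((({(n : ℝ), -(n : ℝ)} : Finset ℝ) ×ˢ (({1, -1} : Finset ℝ) ×ˢ
        (M e).divisors)).image (fun p => F p.1 e p.2.1 p.2.2)).card ≤ 2 * (2 * (M e).divisors.card) := by
        refine Finset.card_image_le.trans ?_
        rw [Finset.card_product, Finset.card_product]
        gcongr
      calc _ ≤ ((2 * (2 * (M e).divisors.card) : ℕ) : ℝ) := by exact_mod_cast h3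
        _ ≤ _ := by push_cast; linarith [hMn e]
    calc _ ≤ ∑ e ∈ Finset.Icc (-(n : ℤ)) n, (4 * K) := by
          refine le_trans ?_ (Finset.sum_le_sum (fun e _ => hcard e))
          exact_mod_cast Finset.card_biUnion_le
      _ = (2 * n + 1) * (4 * K) := by
          rw [Finset.sum_const, nsmul_eq_mul, Int.card_Icc]
          have : (((n : ℤ) + 1 - -n).toNat : ℝ) = 2 * n + 1 := by
            have : ((n : ℤ) + 1 - -n).toNat = 2 * n + 1 := by omega
            rw [this]; push_cast; ring
          rw [this]
      _ ≤ (3 * n) * (4 * K) := by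
          have : (3 : ℝ) ≤ n := by exact_mod_cast hn
          have hK0 : 0 ≤ 4 * K := by positivity
          gcongr
          linarith
      _ = _ := by rw [hK, Real.rpow_add hn0, Real.rpow_one]; ring
  · rintro _ ⟨A, rfl⟩ htr
    have hcoe : ∀ X : SL(2, ℤ), ∀ i j, (Matrix.SpecialLinearGroup.map (n := Fin 2)
      (Int.castRingHom ℝ) X : Matrix (Fin 2) (Fin 2) ℝ) i j = ((X : Matrix (Fin 2) (Fin 2) ℤ) i j : ℝ) :=
      fun X i j => rfl
    have htrZ : |(A : Matrix (Fin 2) (Fin 2) ℤ).trace| = n := by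
      rw [Matrix.trace_fin_two, hcoe, hcoe] at htr
      rw [Matrix.trace_fin_two]
      exact_mod_cast htr
    obtain ⟨V, a, b, c, d, hV, hbc⟩ := exists_conj_reduced A (by rw [htrZ]; exact_mod_cast hn)
    have hdet : a * d - b * c = 1 := by
      have := (V * A * V⁻¹ : SL(2, ℤ)).det_coe
      rwa [hV, Matrix.det_fin_two_of] at this
    have htr2 : |a + d| = n := by
      rw [← htrZ]
      have : (A : Matrix (Fin 2) (Fin 2) ℤ).trace =
          ((V * A * V⁻¹ : SL(2, ℤ)) : Matrix (Fin 2) (Fin 2) ℤ).trace := by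
        rw [Matrix.SpecialLinearGroup.coe_mul, Matrix.trace_mul_comm,
          ← Matrix.SpecialLinearGroup.coe_mul]
        simp
      rw [this, hV, Matrix.trace_fin_two_of]
    have hsq : (a + d) ^ 2 = (n : ℤ) ^ 2 := by rw [← htr2, sq_abs]
    have hdisc : (n : ℤ) ^ 2 - 4 - (a - d) ^ 2 = 4 * (b * c) := by
      linear_combination (-1) * hsq + 4 * hdet
    have hMe : (M (a - d) : ℤ) = b * c := by
      rw [hM]
      simp only
      rw [hdisc, Int.mul_ediv_cancel_left _ (by norm_num), Int.toNat_of_nonneg hbc.le]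
    have he : |a - d| ≤ (n : ℤ) := by
      apply abs_le_of_sq_le_sq _ (by positivity)
      linarith
    have hc0 : c ≠ 0 := by rintro rfl; simp at hbc
    refine ⟨_, ⟨V, rfl⟩, ?_⟩
    rw [Finset.mem_biUnion]
    refine ⟨a - d, Finset.mem_Icc.mpr (abs_le.mp he), ?_⟩
    rw [Finset.mem_image]
    obtain ⟨δ, hδc, s, hs, hsc⟩ :
        ∃ δ : ℕ, (δ : ℤ) ∣ c ∧ ∃ s ∈ ({1, -1} : Finset ℝ), s * δ = c := by
      obtain ⟨δ, rfl | rfl⟩ := Int.eq_nat_or_neg c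
      · exact ⟨δ, dvd_rfl, 1, by simp, by simp⟩
      · exact ⟨δ, by simp, -1, by simp, by simp⟩
    refine ⟨((a + d : ℤ), s, δ), ?_, ?_⟩
    · simp only [Finset.mem_product]
      refine ⟨?_, hs, ?_⟩
      · rw [Finset.mem_insert, Finset.mem_singleton]
        rcases abs_eq (by positivity : (0 : ℤ) ≤ n) |>.mp htr2 with h | h
        · left; exact_mod_cast h
        · right; exact_mod_cast h
      · rw [Nat.mem_divisors]
        constructor
        · rw [← Int.natCast_dvd_natCast, hMe]
          exact hδc.mul_left b
        · intro h0; rw [h0] at hMe; simp at hMe; rcases hMe with h | h <;> simp [h] at hbc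
    · rw [← map_inv, ← map_mul, ← map_mul]
      have hc0' : (c : ℝ) ≠ 0 := by exact_mod_cast hc0
      have hMe' : (M (a - d) : ℝ) = b * c := by exact_mod_cast hMe
      ext i j
      rw [hcoe, hV]
      fin_cases i <;> fin_cases j <;> simp [hF, hsc, hMe', hc0']

/-! ### Orders in quaternion algebras and cocompactness. -/

open MeasureTheory in
/-- Minkowski's theorem on linear forms. -/
theorem exists_int_ne_zero_abs_mulVec_le {ι : Type*} [Fintype ι] [DecidableEq ι]
    (T : Matrix ι ι ℝ) (hT : T.det ≠ 0) {c : ℝ} (hc : 0 < c)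
    (h : |T.det| < c ^ Fintype.card ι) :
    ∃ x : ι → ℤ, x ≠ 0 ∧ ∀ i, |(T *ᵥ fun j => (x j : ℝ)) i| ≤ c := by
  set b := Pi.basisFun ℝ ι
  have : Countable (Submodule.span ℤ (Set.range b)).toAddSubgroup :=
    inferInstanceAs (Countable (Submodule.span ℤ (Set.range b)))
  have fund := ZSpan.isAddFundamentalDomain' b volume
  set s : Set (ι → ℝ) := (Matrix.toLin' T) ⁻¹' (Set.Icc (fun _ => -c) (fun _ => c)) with hs
  have hdet : LinearMap.det (Matrix.toLin' T) ≠ 0 := by rwa [LinearMap.det_toLin']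
  have hvol : volume s = ENNReal.ofReal (|T.det|⁻¹ * (2 * c) ^ Fintype.card ι) := by
    rw [hs, Measure.addHaar_preimage_linearMap _ hdet, LinearMap.det_toLin', abs_inv,
      Real.volume_Icc_pi, ENNReal.ofReal_mul (by positivity), Finset.prod_const,
      ENNReal.ofReal_pow (by positivity), Finset.card_univ]
    congr 4
    ring
  have hF : volume (ZSpan.fundamentalDomain b) = 1 := by
    rw [ZSpan.fundamentalDomain_pi_basisFun, Real.volume_pi_Ico]
    simp
  have hconv : Convex ℝ s := (convex_Icc _ _).linear_preimage _
  have hsymm : ∀ x ∈ s, -x ∈ s := by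
    intro x hx
    simp only [hs, Set.mem_preimage, map_neg, Set.mem_Icc] at hx ⊢
    exact ⟨neg_le_neg hx.2, fun i => by have := hx.1 i; simp at this ⊢; linarith⟩
  obtain ⟨x, hx0, hx⟩ := exists_ne_zero_mem_lattice_of_measure_mul_two_pow_lt_measure fund hsymm hconv
    (by
      rw [hF, one_mul, hvol, Module.finrank_fintype_fun_eq_card]
      rw [show (2 : ℝ≥0∞) ^ Fintype.card ι = ENNReal.ofReal (2 ^ Fintype.card ι) by
        rw [ENNReal.ofReal_pow (by norm_num)]; simp]
      rw [ENNReal.ofReal_lt_ofReal_iff (by positivity), mul_pow, ← mul_assoc, mul_comm _ ((2 : ℝ) ^ _),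
        mul_assoc]
      refine lt_mul_of_one_lt_right (by positivity) ?_
      rw [← div_eq_inv_mul, one_lt_div (by positivity)]
      exact h)
  have hmem : (x : ι → ℝ) ∈ Submodule.span ℤ (Set.range b) := x.2
  rw [b.mem_span_iff_repr_mem ℤ] at hmem
  choose y hy using hmem
  have hxy : (x : ι → ℝ) = fun j => (y j : ℝ) := by
    ext j
    have := hy j
    simp [b] at this
    exact this.symm
  refine ⟨y, ?_, ?_⟩
  · rintro rfl
    apply hx0
    ext j
    rw [hxy]; simp
  · intro i
    rw [← hxy, abs_le]
    exact ⟨hx.1 i, hx.2 i⟩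

/-- The element of the quaternion algebra with given integral coordinates. -/
def intQuat {a b : ℕ} (x : Fin 4 → ℤ) : QuatAlg a b := ⟨x 0, x 1, x 2, x 3⟩

/-- The reduced norm in terms of integral coordinates. -/
def intQuatNorm (a b : ℕ) (x : Fin 4 → ℤ) : ℤ :=
  x 0 ^ 2 - x 1 ^ 2 * a - x 2 ^ 2 * b + x 3 ^ 2 * (a * b)

theorem quatNorm_intQuat {a b : ℕ} (x : Fin 4 → ℤ) :
    quatNorm (intQuat x : QuatAlg a b) = intQuatNorm a b x := by
  simp [quatNorm, intQuat, intQuatNorm]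

theorem quatNorm_mul {a b : ℕ} (p q : QuatAlg a b) : quatNorm (p * q) = quatNorm p * quatNorm q := by
  simp [quatNorm]; ring

theorem mul_star_eq_quatNorm {a b : ℕ} (q : QuatAlg a b) :
    q * star q = ((quatNorm q : ℚ) : QuatAlg a b) := by
  obtain ⟨n, hn⟩ : ∃ n, n = quatNorm q := ⟨_, rfl⟩
  rw [← hn]
  unfold quatNorm at hn
  ext <;> simp <;> linarith

/-- In a division algebra `q * star q = 0` forces `q = 0`. Cocompactness rests on this. -/
theorem quatNorm_ne_zero {a b : ℕ} (hdiv : ∀ x : QuatAlg a b, x ≠ 0 → IsUnit x) {q : QuatAlg a b}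
    (hq : q ≠ 0) : quatNorm q ≠ 0 := by
  intro h
  have h1 := mul_star_eq_quatNorm q
  rw [h] at h1
  have h2 : star q = 0 := (hdiv q hq).mul_right_eq_zero.mp (by rw [h1]; simp)
  exact hq (star_eq_zero.mp h2)

theorem IsQuatOrder.exists_denominator {a b : ℕ} {O : Subalgebra ℤ (QuatAlg a b)}
    (hO : IsQuatOrder O) : ∃ K : ℕ, 0 < K ∧ ∀ q ∈ O, ∃ x : Fin 4 → ℤ,
      (K : ℚ) • q = (intQuat x : QuatAlg a b) := by
  suffices H : ∀ N : Submodule ℤ (QuatAlg a b), N.FG → ∃ K : ℕ, 0 < K ∧ ∀ q ∈ N, ∃ x : Fin 4 → ℤ,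
      (K : ℚ) • q = (intQuat x : QuatAlg a b) from H _ hO.1
  intro N hN
  induction N, hN using Submodule.fg_induction with
  | singleton q =>
    refine ⟨q.re.den * q.imI.den * q.imJ.den * q.imK.den, by positivity, ?_⟩
    intro p hp
    obtain ⟨z, rfl⟩ := Submodule.mem_span_singleton.mp hp
    refine ⟨![z * (q.re.num * q.imI.den * q.imJ.den * q.imK.den),
      z * (q.re.den * q.imI.num * q.imJ.den * q.imK.den),
      z * (q.re.den * q.imI.den * q.imJ.num * q.imK.den),
      z * (q.re.den * q.imI.den * q.imJ.den * q.imK.num)], ?_⟩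
    have h0 := Rat.mul_den_eq_num q.re
    have h1 := Rat.mul_den_eq_num q.imI
    have h2 := Rat.mul_den_eq_num q.imJ
    have h3 := Rat.mul_den_eq_num q.imK
    ext
    · simp [intQuat]; rw [← h0]; ring
    · simp [intQuat]; rw [← h1]; ring
    · simp [intQuat]; rw [← h2]; ring
    · simp [intQuat]; rw [← h3]; ring
  | sup N₁ N₂ _ _ h₁ h₂ =>
    obtain ⟨K₁, hK₁, h₁⟩ := h₁
    obtain ⟨K₂, hK₂, h₂⟩ := h₂
    refine ⟨K₁ * K₂, by positivity, ?_⟩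
    intro q hq
    obtain ⟨q₁, hq₁, q₂, hq₂, rfl⟩ := Submodule.mem_sup.mp hq
    obtain ⟨x, hx⟩ := h₁ q₁ hq₁
    obtain ⟨y, hy⟩ := h₂ q₂ hq₂
    refine ⟨fun i => K₂ * x i + K₁ * y i, ?_⟩
    have : ((K₁ * K₂ : ℕ) : ℚ) • (q₁ + q₂) = (K₂ : ℚ) • ((K₁ : ℚ) • q₁) + (K₁ : ℚ) • ((K₂ : ℚ) • q₂) := by
      push_cast; module
    rw [this, hx, hy]
    ext <;> simp [intQuat]

theorem IsQuatOrder.exists_smul_intQuat_mem {a b : ℕ} {O : Subalgebra ℤ (QuatAlg a b)}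
    (hO : IsQuatOrder O) : ∃ k : ℕ, 0 < k ∧ ∀ x : Fin 4 → ℤ,
      (k : ℚ) • (intQuat x : QuatAlg a b) ∈ O := by
  have hnat : ∀ (k : ℤ) (q : QuatAlg a b), q ∈ O → (k : ℚ) • q ∈ O := by
    intro k q hq
    have : (k : ℚ) • q = k • q := by rw [Int.cast_smul_eq_zsmul]
    rw [this]
    exact O.smul_mem hq k
  have key : ∀ q : QuatAlg a b, ∃ k : ℕ, 0 < k ∧ (k : ℚ) • q ∈ O := by
    intro q
    have hq : q ∈ Submodule.span ℚ (O : Set (QuatAlg a b)) := by rw [hO.2]; trivial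
    induction hq using Submodule.span_induction with
    | mem q hq => exact ⟨1, one_pos, by simpa using hq⟩
    | zero => exact ⟨1, one_pos, by simp⟩
    | add p q _ _ hp hq =>
      obtain ⟨k, hk, hp⟩ := hp
      obtain ⟨l, hl, hq⟩ := hq
      refine ⟨k * l, by positivity, ?_⟩
      have : ((k * l : ℕ) : ℚ) • (p + q) = ((l : ℤ) : ℚ) • ((k : ℚ) • p) + ((k : ℤ) : ℚ) • ((l : ℚ) • q) := by
        push_cast; module
      rw [this]
      exact O.add_mem (hnat _ _ hp) (hnat _ _ hq)
    | smul r q _ hq =>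
      obtain ⟨k, hk, hq⟩ := hq
      refine ⟨k * r.den, by positivity, ?_⟩
      have : ((k * r.den : ℕ) : ℚ) • (r • q) = (r.num : ℚ) • ((k : ℚ) • q) := by
        rw [← Rat.mul_den_eq_num r]; push_cast; module
      rw [this]
      exact hnat _ _ hq
  obtain ⟨k₁, hk₁, h₁⟩ := key ⟨0, 1, 0, 0⟩
  obtain ⟨k₂, hk₂, h₂⟩ := key ⟨0, 0, 1, 0⟩
  obtain ⟨k₃, hk₃, h₃⟩ := key ⟨0, 0, 0, 1⟩
  refine ⟨k₁ * k₂ * k₃, by positivity, fun x => ?_⟩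
  have : ((k₁ * k₂ * k₃ : ℕ) : ℚ) • (intQuat x : QuatAlg a b) =
      ((k₁ * k₂ * k₃ * x 0 : ℤ) : ℚ) • (1 : QuatAlg a b) +
      ((k₂ * k₃ * x 1 : ℤ) : ℚ) • ((k₁ : ℚ) • (⟨0, 1, 0, 0⟩ : QuatAlg a b)) +
      ((k₁ * k₃ * x 2 : ℤ) : ℚ) • ((k₂ : ℚ) • (⟨0, 0, 1, 0⟩ : QuatAlg a b)) +
      ((k₁ * k₂ * x 3 : ℤ) : ℚ) • ((k₃ : ℚ) • (⟨0, 0, 0, 1⟩ : QuatAlg a b)) := by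
    ext <;> simp [intQuat] <;> ring
  rw [this]
  exact O.add_mem (O.add_mem (O.add_mem (hnat _ _ O.one_mem) (hnat _ _ h₁)) (hnat _ _ h₂)) (hnat _ _ h₃)

theorem quatMatrix_trace {a b : ℕ} (q : QuatAlg a b) : (quatMatrix q).trace = 2 * q.re := by
  simp [quatMatrix, Matrix.trace_fin_two]; ring

/-- The trace is `q + star q`, a rational number lying in the order, hence integral over `ℤ`. -/
theorem exists_int_trace_eq_of_mem_quatGroup {a b : ℕ} {O : Subalgebra ℤ (QuatAlg a b)}
    (hO : IsQuatOrder O) {A : SL(2, ℝ)} (hA : A ∈ quatGroup O hO) :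
    ∃ z : ℤ, (A : Matrix (Fin 2) (Fin 2) ℝ).trace = z := by
  obtain ⟨q, hq, hq1, hqA⟩ := hA
  have hs := hO.star_mem hq hq1
  have hmem : algebraMap ℚ (QuatAlg a b) (2 * q.re) ∈ O := by
    have : algebraMap ℚ (QuatAlg a b) (2 * q.re) = q + star q := by
      ext <;> simp [QuaternionAlgebra.algebraMap_eq]; ring
    rw [this]
    exact O.add_mem hq hs
  have hint : IsIntegral ℤ (2 * q.re) :=
    (isIntegral_algebraMap_iff (FaithfulSMul.algebraMap_injective ℚ (QuatAlg a b))).mp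
      (IsIntegral.of_mem_of_fg O hO.1 _ hmem)
  obtain ⟨z, hz⟩ := IsIntegrallyClosed.isIntegral_iff.mp hint
  refine ⟨z, ?_⟩
  rw [← hqA, quatMatrix_trace]
  have : 2 * q.re = z := by simpa using hz.symm
  exact_mod_cast this

theorem intQuat_ne_zero {a b : ℕ} {x : Fin 4 → ℤ} (hx : x ≠ 0) : (intQuat x : QuatAlg a b) ≠ 0 := by
  intro h
  apply hx
  have h0 := congrArg QuaternionAlgebra.re h
  have h1 := congrArg QuaternionAlgebra.imI h
  have h2 := congrArg QuaternionAlgebra.imJ h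
  have h3 := congrArg QuaternionAlgebra.imK h
  simp [intQuat] at h0 h1 h2 h3
  ext i
  fin_cases i <;> simp [h0, h1, h2, h3]

/-- The entries of `quatMatrix (intQuat x) * g` are four linear forms in `x` whose determinant is
`4ab` whatever `g` is, so Minkowski's theorem gives a bound uniform in `g`. -/
theorem exists_intQuat_mul_bounded {a b : ℕ} (ha : 0 < a) (hb : 0 < b) (g : SL(2, ℝ)) :
    ∃ x : Fin 4 → ℤ, x ≠ 0 ∧ ∀ i j,
      |(quatMatrix (intQuat x : QuatAlg a b) * (g : Matrix (Fin 2) (Fin 2) ℝ)) i j| ≤ 4 * a * b + 1 := by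
  have hdet := SL2_det_eq g
  set p := (g : Matrix (Fin 2) (Fin 2) ℝ) 0 0 with hp
  set q := (g : Matrix (Fin 2) (Fin 2) ℝ) 0 1 with hq
  set r := (g : Matrix (Fin 2) (Fin 2) ℝ) 1 0 with hr
  set s := (g : Matrix (Fin 2) (Fin 2) ℝ) 1 1 with hs
  have ha2 : √(a : ℝ) ^ 2 = a := Real.sq_sqrt (Nat.cast_nonneg a)
  have hb2 : √(b : ℝ) ^ 2 = b := Real.sq_sqrt (Nat.cast_nonneg b)
  have hab : √((a : ℝ) * b) = √(a : ℝ) * √(b : ℝ) := Real.sqrt_mul (Nat.cast_nonneg a) _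
  set u := √(a : ℝ) with hu
  set v := √(b : ℝ) with hv
  set T : Matrix (Fin 4) (Fin 4) ℝ :=
    !![p, p * u, r * v, r * (u * v);
       q, q * u, s * v, s * (u * v);
       r, -(r * u), p * v, -(p * (u * v));
       s, -(s * u), q * v, -(q * (u * v))] with hT
  have hTdet : T.det = 4 * a * b := by
    rw [← ha2, ← hb2]
    have : T.det = 4 * u ^ 2 * v ^ 2 * (p * s - q * r) ^ 2 := by
      simp [hT, Matrix.det_succ_row_zero, Fin.sum_univ_succ, Fin.succAbove]
      ring
    rw [this, hdet]; ring
  have hab1 : (1 : ℝ) ≤ a * b := by exact_mod_cast Nat.mul_pos ha hb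
  obtain ⟨x, hx0, hx⟩ := exists_int_ne_zero_abs_mulVec_le T (by rw [hTdet]; positivity)
    (show (0 : ℝ) < 4 * a * b + 1 by positivity) (by
      rw [hTdet, abs_of_nonneg (by positivity), Fintype.card_fin]
      calc (4 * a * b : ℝ) < 4 * a * b + 1 := by linarith
        _ ≤ _ := le_self_pow₀ (by nlinarith) (by norm_num))
  refine ⟨x, hx0, fun i j => ?_⟩
  have h0 := hx 0
  have h1 := hx 1
  have h2 := hx 2
  have h3 := hx 3
  simp only [hT, Matrix.mulVec, dotProduct, Fin.sum_univ_four] at h0 h1 h2 h3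
  simp at h0 h1 h2 h3
  fin_cases i <;> fin_cases j <;>
    simp [Matrix.mul_apply, quatMatrix, intQuat, hab, ← hp, ← hq, ← hr, ← hs, ← hu, ← hv]
  · convert h0 using 2; ring
  · convert h1 using 2; ring
  · convert h2 using 2; ring
  · convert h3 using 2; ring

/-- If `q ≡ p` modulo a suitable multiple of the common norm of `p` and `q`, then `p⁻¹ q` is a unit
of the order. -/
theorem IsQuatOrder.exists_unit_mul_eq {a b : ℕ} {O : Subalgebra ℤ (QuatAlg a b)}
    (hO : IsQuatOrder O) {k : ℕ} (hk : ∀ x : Fin 4 → ℤ, (k : ℚ) • (intQuat x : QuatAlg a b) ∈ O)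
    {x y z : Fin 4 → ℤ} (hN : intQuatNorm a b x = intQuatNorm a b y) (h0 : intQuatNorm a b y ≠ 0)
    (hxy : ∀ i, x i = y i + k * intQuatNorm a b y * z i) :
    ∃ U ∈ quatGroup O hO, quatMatrix (intQuat y : QuatAlg a b) * (U : Matrix (Fin 2) (Fin 2) ℝ) =
      quatMatrix (intQuat x : QuatAlg a b) := by
  set m := intQuatNorm a b y with hm
  obtain ⟨w, hw⟩ : ∃ w : Fin 4 → ℤ,
      (intQuat w : QuatAlg a b) = star (intQuat y : QuatAlg a b) * intQuat z := by
    refine ⟨![y 0 * z 0 - a * y 1 * z 1 - b * y 2 * z 2 + a * b * y 3 * z 3,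
      y 0 * z 1 - y 1 * z 0 + b * y 2 * z 3 - b * y 3 * z 2,
      y 0 * z 2 - a * y 1 * z 3 - y 2 * z 0 + a * y 3 * z 1,
      y 0 * z 3 - y 1 * z 2 + y 2 * z 1 - y 3 * z 0], ?_⟩
    ext <;> simp [intQuat] <;> ring
  -- With this `u`, `y u = y + k (y * star y) z = y + k m z = x`.
  set u : QuatAlg a b := 1 + (k : ℚ) • intQuat w with hu
  have huO : u ∈ O := O.add_mem O.one_mem (hk w)
  have hyu : (intQuat y : QuatAlg a b) * u = intQuat x := by
    have h1 : (intQuat x : QuatAlg a b) = intQuat y + ((k * m : ℚ)) • intQuat z := by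
      ext <;> simp [intQuat, hxy]
    rw [h1, hu, mul_add, mul_one, hw, mul_smul_comm, ← mul_assoc, mul_star_eq_quatNorm,
      quatNorm_intQuat, ← hm]
    congr 1
    ext <;> simp <;> ring
  have hun : quatNorm u = 1 := by
    have := quatNorm_mul (intQuat y : QuatAlg a b) u
    rw [hyu, quatNorm_intQuat, quatNorm_intQuat, hN, ← hm] at this
    have hm0 : (m : ℚ) ≠ 0 := by exact_mod_cast h0
    exact mul_left_cancel₀ hm0 (by rw [← this, mul_one])
  refine ⟨⟨quatMatrix u, by rw [det_quatMatrix, hun]; simp⟩, ⟨u, huO, hun, rfl⟩, ?_⟩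
  rw [← hyu, quatMatrix_mul]

/-- Solve for `X` with the adjugate; dividing by a determinant of absolute value at least `1` only
helps. -/
theorem abs_entry_le_of_mul {P X Q : Matrix (Fin 2) (Fin 2) ℝ} (h : P * X = Q) (hdet : 1 ≤ |P.det|)
    {c R : ℝ} (hP : ∀ i j, |P i j| ≤ c) (hQ : ∀ i j, |Q i j| ≤ R) (i j : Fin 2) :
    |X i j| ≤ 2 * c * R := by
  have h1 : P.det • X = P.adjugate * Q := by
    rw [← h, ← Matrix.mul_assoc, Matrix.adjugate_mul]
    simp
  have hadj : ∀ i j, |P.adjugate i j| ≤ c := by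
    intro i j
    rw [Matrix.adjugate_fin_two]
    fin_cases i <;> fin_cases j <;> simp [hP]
  have h2 := congrFun (congrFun h1 i) j
  rw [Matrix.smul_apply, smul_eq_mul, Matrix.mul_apply, Fin.sum_univ_two] at h2
  have hc : 0 ≤ c := (abs_nonneg _).trans (hP 0 0)
  calc |X i j| ≤ |P.det| * |X i j| := le_mul_of_one_le_left (abs_nonneg _) hdet
    _ = |P.adjugate i 0 * Q 0 j + P.adjugate i 1 * Q 1 j| := by rw [← abs_mul, h2]
    _ ≤ |P.adjugate i 0 * Q 0 j| + |P.adjugate i 1 * Q 1 j| := abs_add_le _ _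
    _ = |P.adjugate i 0| * |Q 0 j| + |P.adjugate i 1| * |Q 1 j| := by rw [abs_mul, abs_mul]
    _ ≤ c * R + c * R := by gcongr <;> first | exact hadj _ _ | exact hQ _ _
    _ = _ := by ring

/-- The group `Γ_O` of an order in a division algebra is cocompact in `SL(2, ℝ)`. -/
theorem IsQuatOrder.exists_bounded_translate {a b : ℕ} (ha : 0 < a) (hb : 0 < b)
    (hdiv : ∀ x : QuatAlg a b, x ≠ 0 → IsUnit x) {O : Subalgebra ℤ (QuatAlg a b)}
    (hO : IsQuatOrder O) :
    ∃ R : ℝ, ∀ g : SL(2, ℝ), ∃ u ∈ quatGroup O hO, ∀ i j,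
      |((u * g : SL(2, ℝ)) : Matrix (Fin 2) (Fin 2) ℝ) i j| ≤ R := by
  obtain ⟨k, hk0, hk⟩ := hO.exists_smul_intQuat_mem
  set c : ℝ := 4 * a * b + 1 with hc
  obtain ⟨B, hB⟩ := exists_nat_gt (2 * c ^ 2)
  set good : SL(2, ℝ) → (Fin 4 → ℤ) → Prop := fun g x => x ≠ 0 ∧ ∀ i j,
    |(quatMatrix (intQuat x : QuatAlg a b) * (g : Matrix (Fin 2) (Fin 2) ℝ)) i j| ≤ c with hgood
  -- Quaternions with equal codes differ by a unit of the order on the right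
  -- (`IsQuatOrder.exists_unit_mul_eq`). The norm is a nonzero integer bounded by `2c²`, so only
  -- finitely many codes occur.
  set code : (Fin 4 → ℤ) → ℤ × (Fin 4 → ℤ) :=
    fun x => (intQuatNorm a b x, fun i => x i % (k * intQuatNorm a b x)) with hcode
  set T : Finset (ℤ × (Fin 4 → ℤ)) :=
    Finset.Icc (-(B : ℤ)) B ×ˢ Fintype.piFinset (fun _ => Finset.Icc (0 : ℤ) (k * B)) with hT
  have hnz : ∀ x : Fin 4 → ℤ, x ≠ 0 → intQuatNorm a b x ≠ 0 := by
    intro x hx h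
    apply quatNorm_ne_zero hdiv (intQuat_ne_zero hx)
    rw [quatNorm_intQuat, h, Int.cast_zero]
  have hcodeT : ∀ g x, good g x → code x ∈ T := by
    intro g x hx
    have hdet : |(intQuatNorm a b x : ℝ)| < B := by
      have h1 : (quatMatrix (intQuat x : QuatAlg a b) * (g : Matrix (Fin 2) (Fin 2) ℝ)).det =
          intQuatNorm a b x := by
        rw [Matrix.det_mul, det_quatMatrix, g.det_coe, mul_one, quatNorm_intQuat]
        simp
      rw [← h1, Matrix.det_fin_two]
      refine lt_of_le_of_lt ?_ hB
      refine (abs_sub _ _).trans ?_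
      rw [abs_mul, abs_mul, two_mul, sq]
      have hc0 : 0 ≤ c := by positivity
      gcongr <;> exact hx.2 _ _
    have hdet' : |intQuatNorm a b x| < B := by exact_mod_cast hdet
    rw [hT, Finset.mem_product, Fintype.mem_piFinset]
    refine ⟨Finset.mem_Icc.mpr (abs_le.mp hdet'.le), fun i => Finset.mem_Icc.mpr ?_⟩
    have hne : (k : ℤ) * intQuatNorm a b x ≠ 0 :=
      mul_ne_zero (by exact_mod_cast hk0.ne') (hnz x hx.1)
    refine ⟨Int.emod_nonneg _ hne, ?_⟩
    refine (Int.emod_lt_abs _ hne).le.trans ?_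
    rw [abs_mul, Nat.abs_cast]
    gcongr
  -- One reference `y` is fixed per code. If `x` is good for `g` and `x = y U`, then `P (U g)` is
  -- the bounded matrix of `x` times `g`, with `P` depending only on the code; hence `U g` is
  -- bounded.
  have hbound : ∀ t : ℤ × (Fin 4 → ℤ), ∃ R : ℝ, 0 ≤ R ∧ ∀ g x, good g x → code x = t →
      ∃ u ∈ quatGroup O hO, ∀ i j, |((u * g : SL(2, ℝ)) : Matrix (Fin 2) (Fin 2) ℝ) i j| ≤ R := by
    intro t
    by_cases hex : ∃ g y, good g y ∧ code y = t
    · obtain ⟨g₀, y, hy, rfl⟩ := hex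
      set P := quatMatrix (intQuat y : QuatAlg a b) with hP
      obtain ⟨d, hd⟩ : ∃ d : ℝ, ∀ i j, |P i j| ≤ d :=
        ⟨∑ i, ∑ j, |P i j|, fun i j => (Finset.single_le_sum (f := fun j => |P i j|)
          (fun _ _ => abs_nonneg _) (Finset.mem_univ j)).trans
          (Finset.single_le_sum (f := fun i => ∑ j, |P i j|)
            (fun _ _ => Finset.sum_nonneg (fun _ _ => abs_nonneg _)) (Finset.mem_univ i))⟩
      have hd0 : 0 ≤ d := (abs_nonneg _).trans (hd 0 0)
      refine ⟨2 * d * c, by positivity, fun g x hx hxy => ?_⟩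
      simp only [hcode, Prod.mk.injEq] at hxy
      obtain ⟨hN, hmod⟩ := hxy
      rw [hN] at hmod
      have hz : ∀ i, ∃ z, x i = y i + k * intQuatNorm a b y * z := by
        intro i
        obtain ⟨z, hz⟩ := Int.ModEq.dvd (congrFun hmod i).symm
        exact ⟨z, by linarith⟩
      choose z hz using hz
      obtain ⟨U, hU, hUeq⟩ := hO.exists_unit_mul_eq hk hN (hnz y hy.1) hz
      refine ⟨U, hU, ?_⟩
      refine abs_entry_le_of_mul (P := P) (Q := quatMatrix (intQuat x : QuatAlg a b) *
        (g : Matrix (Fin 2) (Fin 2) ℝ)) ?_ ?_ hd hx.2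
      · rw [Matrix.SpecialLinearGroup.coe_mul, ← Matrix.mul_assoc, hUeq]
      · rw [hP, det_quatMatrix, quatNorm_intQuat]
        have := Int.one_le_abs (hnz y hy.1)
        exact_mod_cast this
    · exact ⟨0, le_rfl, fun g x hx hxt => (hex ⟨g, x, hx, hxt⟩).elim⟩
  choose R hR0 hR using hbound
  refine ⟨∑ t ∈ T, R t, fun g => ?_⟩
  obtain ⟨x, hx⟩ := exists_intQuat_mul_bounded ha hb g
  obtain ⟨u, hu, hub⟩ := hR (code x) g x hx rfl
  exact ⟨u, hu, fun i j => (hub i j).trans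
    (Finset.single_le_sum (fun t _ => hR0 t) (hcodeT g x hx))⟩

/-! ### Counting classes in the quaternion groups. -/

theorem hasSmallConjCovers_quatGroup {a b : ℕ} (ha : 0 < a) (hb : 0 < b)
    (hdiv : ∀ x : QuatAlg a b, x ≠ 0 → IsUnit x) {O : Subalgebra ℤ (QuatAlg a b)}
    (hO : IsQuatOrder O) : HasSmallConjCovers (quatGroup O hO) := by
  classical
  intro ε hε
  obtain ⟨R, hR⟩ := hO.exists_bounded_translate ha hb hdiv
  obtain ⟨K, hK0, hK⟩ := hO.exists_denominator
  have hab0 : 0 < a * b := Nat.mul_pos ha hb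
  obtain ⟨C, hC, hreps⟩ := exists_card_formReps_le_rpow (a * b) hab0 (ε / 2) (by positivity)
  set D : ℝ := a * (K ^ 2 + 4 * a * b * (K * R ^ 2) ^ 2) with hD
  have ha' : (0 : ℝ) < a := by exact_mod_cast ha
  have hb' : (0 : ℝ) < b := by exact_mod_cast hb
  have hK' : (0 : ℝ) < K := by exact_mod_cast hK0
  have hD0 : 0 < D := by positivity
  refine ⟨(2 * (K * R ^ 2) + 1) * (2 * (C * D ^ (ε / 2))), by positivity, fun n hn => ?_⟩
  have hn0 : (0 : ℝ) < n := by exact_mod_cast (by omega : 0 < n)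
  set Z : ℕ := ⌊K * R ^ 2 * n⌋₊ with hZ
  have hZle : (Z : ℝ) ≤ K * R ^ 2 * n := Nat.floor_le (by positivity)
  -- With `K q` of integral coordinates `x` and `2 q₀ = ± n`, the norm equation multiplied by `4aK²`
  -- reads `(2a x₁)² + ab (2 x₂)² = M x₃`. `Z` bounds `|x₃|`, and `D n²` bounds `M` on that range.
  set M : ℤ → ℕ := fun z => a * (K ^ 2 * (n ^ 2 - 4) + 4 * (a * b) * z.natAbs ^ 2) with hM
  have hn4 : 0 < n ^ 2 - 4 := by have : 3 ^ 2 ≤ n ^ 2 := Nat.pow_le_pow_left hn 2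
                                 omega
  have hM0 : ∀ z, 0 < M z := fun z => by positivity
  set F : ℚ → ℤ → ℤ × ℤ → Matrix (Fin 2) (Fin 2) ℝ := fun t z p =>
    quatMatrix (⟨t / 2, p.1 / (2 * a * K), p.2 / (2 * K), z / K⟩ : QuatAlg a b) with hF
  refine ⟨(Finset.Icc (-(Z : ℤ)) Z).biUnion (fun z =>
    (({(n : ℚ), -(n : ℚ)} : Finset ℚ) ×ˢ formReps (a * b) (M z)).image
      (fun p => F p.1 z p.2)), ?_, ?_⟩
  · set L : ℝ := C * (D ^ (ε / 2) * (n : ℝ) ^ ε) with hL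
    have hcard : ∀ z ∈ Finset.Icc (-(Z : ℤ)) Z,
        ((((({(n : ℚ), -(n : ℚ)} : Finset ℚ) ×ˢ formReps (a * b) (M z)).image
          (fun p => F p.1 z p.2)).card : ℕ) : ℝ) ≤ 2 * L := by
      intro z hz
      have hzZ : |(z : ℝ)| ≤ K * R ^ 2 * n := by
        have := abs_le.mpr (Finset.mem_Icc.mp hz)
        calc |(z : ℝ)| ≤ Z := by exact_mod_cast this
          _ ≤ _ := hZle
      have hMle : (M z : ℝ) ≤ D * (n : ℝ) ^ 2 := by
        have h1 : (((n ^ 2 - 4 : ℕ)) : ℝ) ≤ (n : ℝ) ^ 2 := by exact_mod_cast Nat.sub_le _ _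
        calc (M z : ℝ) = a * (K ^ 2 * ((n ^ 2 - 4 : ℕ) : ℝ) + 4 * (a * b) * |(z : ℝ)| ^ 2) := by
              rw [hM]; push_cast; simp
          _ ≤ a * (K ^ 2 * (n : ℝ) ^ 2 + 4 * (a * b) * (K * R ^ 2 * n) ^ 2) := by gcongr
          _ = _ := by rw [hD]; ring
      have hr : ((formReps (a * b) (M z)).card : ℝ) ≤ L := by
        calc ((formReps (a * b) (M z)).card : ℝ) ≤ C * (M z : ℝ) ^ (ε / 2) := hreps _ (hM0 z)
          _ ≤ C * (D * (n : ℝ) ^ 2) ^ (ε / 2) := by gcongr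
          _ = L := by
            rw [hL, Real.mul_rpow hD0.le (by positivity), ← Real.rpow_natCast, ← Real.rpow_mul hn0.le]
            congr 3; push_cast; ring
      have h3 : ((({(n : ℚ), -(n : ℚ)} : Finset ℚ) ×ˢ formReps (a * b) (M z)).image
          (fun p => F p.1 z p.2)).card ≤ 2 * (formReps (a * b) (M z)).card := by
        refine Finset.card_image_le.trans ?_
        rw [Finset.card_product]
        gcongr
        exact Finset.card_le_two
      calc _ ≤ ((2 * (formReps (a * b) (M z)).card : ℕ) : ℝ) := by exact_mod_cast h3
        _ ≤ _ := by push_cast; linarith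
    calc _ ≤ ∑ z ∈ Finset.Icc (-(Z : ℤ)) Z, (2 * L) := by
          refine le_trans ?_ (Finset.sum_le_sum hcard)
          exact_mod_cast Finset.card_biUnion_le
      _ = (2 * Z + 1) * (2 * L) := by
          rw [Finset.sum_const, nsmul_eq_mul, Int.card_Icc]
          have : ((Z : ℤ) + 1 - -Z).toNat = 2 * Z + 1 := by omega
          rw [this]; push_cast; ring
      _ ≤ ((2 * (K * R ^ 2) + 1) * n) * (2 * L) := by
          have hn1 : (1 : ℝ) ≤ n := by exact_mod_cast (by omega : 1 ≤ n)
          have hL0 : 0 ≤ 2 * L := by positivity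
          gcongr
          linarith
      _ = _ := by rw [hL, Real.rpow_add hn0, Real.rpow_one]; ring
  · intro A hA htr
    have hn2 : (2 : ℝ) < n := by exact_mod_cast hn
    obtain ⟨g, l, m, hlm, rfl⟩ := exists_conj_diagSL A (by rw [htr]; exact hn2)
    have htr' := htr
    rw [SL2_trace_conj, diagSL_trace_abs] at htr
    obtain ⟨u, hu, hub⟩ := hR g
    refine ⟨u, hu, ?_⟩
    have hmem := (quatGroup O hO).mul_mem ((quatGroup O hO).mul_mem hu hA)
      ((quatGroup O hO).inv_mem hu)
    rw [← SL2_trace_conj u] at htr'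
    -- The conjugate of `A` by `u` is diagonalised by the bounded matrix `u g`, so its off-diagonal
    -- difference is `O(n)`.
    have hoff := abs_sub_conj_diagSL_le (u * g) hub hlm
    rw [htr] at hoff
    rw [show u * g * diagSL l m hlm * (u * g)⁻¹ = u * (g * diagSL l m hlm * g⁻¹) * u⁻¹ by group] at hoff
    obtain ⟨q, hq, hqn, hqB⟩ := hmem
    rw [← hqB] at htr' hoff ⊢
    obtain ⟨x, hx⟩ := hK q hq
    have hKq : (K : ℚ) ≠ 0 := by exact_mod_cast hK0.ne'
    have e0 : (K : ℚ) * q.re = x 0 := by simpa [intQuat] using congrArg QuaternionAlgebra.re hx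
    have e1 : (K : ℚ) * q.imI = x 1 := by simpa [intQuat] using congrArg QuaternionAlgebra.imI hx
    have e2 : (K : ℚ) * q.imJ = x 2 := by simpa [intQuat] using congrArg QuaternionAlgebra.imJ hx
    have e3 : (K : ℚ) * q.imK = x 3 := by simpa [intQuat] using congrArg QuaternionAlgebra.imK hx
    have htq : |2 * q.re| = n := by
      rw [quatMatrix_trace] at htr'
      exact_mod_cast htr'
    have hx3 : |x 3| ≤ (Z : ℤ) := by
      have h1 : (quatMatrix q) 0 1 - (quatMatrix q) 1 0 = 2 * √((a : ℝ) * b) * q.imK := by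
        simp [quatMatrix]; ring
      have h2 : 1 ≤ √((a : ℝ) * b) := by
        rw [Real.one_le_sqrt]; exact_mod_cast hab0
      rw [h1, abs_mul, abs_of_nonneg (by positivity)] at hoff
      have h3 : |(q.imK : ℝ)| ≤ R ^ 2 * n := by
        have := mul_le_mul_of_nonneg_right h2 (abs_nonneg (q.imK : ℝ))
        linarith
      have h4 : ((|x 3| : ℤ) : ℝ) ≤ K * R ^ 2 * n := by
        have : (x 3 : ℝ) = K * q.imK := by exact_mod_cast e3.symm
        rw [Int.cast_abs, this, abs_mul, Nat.abs_cast, mul_assoc]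
        gcongr
      rw [Int.abs_eq_natAbs]
      exact Int.ofNat_le.mpr (Nat.le_floor (by rw [Nat.cast_natAbs]; exact h4))
    rw [Finset.mem_biUnion]
    refine ⟨x 3, Finset.mem_Icc.mpr (abs_le.mp hx3), ?_⟩
    rw [Finset.mem_image]
    refine ⟨(2 * q.re, (2 * a * x 1, 2 * x 2)), ?_, ?_⟩
    · rw [Finset.mem_product]
      constructor
      · rw [Finset.mem_insert, Finset.mem_singleton]
        exact (abs_eq (by positivity)).mp htq
      · rw [mem_formReps hab0]
        have hsq : (2 * q.re) ^ 2 = (n : ℚ) ^ 2 := by rw [← htq, sq_abs]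
        unfold quatNorm at hqn
        have hcast : ((n ^ 2 - 4 : ℕ) : ℚ) = (n : ℚ) ^ 2 - 4 := by
          rw [Nat.cast_sub (by omega)]; push_cast; ring
        have habs : ((x 3).natAbs : ℚ) ^ 2 = (x 3 : ℚ) ^ 2 := by
          rw [Nat.cast_natAbs]; push_cast; rw [sq_abs]
        have key : (2 * a * x 1 : ℚ) ^ 2 + (a * b) * (2 * x 2) ^ 2 = M (x 3) := by
          rw [hM]
          push_cast
          rw [hcast, habs, ← e1, ← e2, ← e3, ← hsq]
          linear_combination (-4 * (a : ℚ) * K ^ 2) * hqn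
        exact_mod_cast key
    · have haq : (a : ℚ) ≠ 0 := by exact_mod_cast ha.ne'
      rw [hF]
      simp only
      congr 1
      ext
      · simp
      · push_cast; rw [← e1]; field_simp
      · push_cast; rw [← e2]; field_simp
      · rw [← e3]; field_simp

/-! ### Integrality of traces in the modular group, and the conclusion. -/

theorem exists_int_trace_eq_of_mem_modularGroupReal {A : SL(2, ℝ)} (hA : A ∈ modularGroupReal) :
    ∃ z : ℤ, (A : Matrix (Fin 2) (Fin 2) ℝ).trace = z := by
  obtain ⟨A, rfl⟩ := hA
  refine ⟨(A : Matrix (Fin 2) (Fin 2) ℤ).trace, ?_⟩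
  rw [Matrix.trace_fin_two, Matrix.trace_fin_two]
  push_cast
  rfl

theorem lemma1 (G Γ : Subgroup SL(2, ℝ))
    (hG : G = modularGroupReal ∨ IsQuaternionGroup G)
    (hΓ : Γ ≤ G) (hfin : Γ.relIndex G ≠ 0)
    (ε : ℝ) (hε : 0 < ε) :
    ∃ C : ℝ, 0 < C ∧ ∀ n : ℕ, 1 ≤ n →
      traceMult Γ n ≤ ENNReal.ofReal (C * (n : ℝ) ^ (1 + ε)) := by
  rcases hG with rfl | ⟨a, b, O, hO, ha, hb, -, -, -, hdiv, rfl⟩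
  · exact (hasSmallConjCovers_modularGroupReal.of_relIndex_ne_zero hΓ hfin).traceMult_le
      (fun A hA => exists_int_trace_eq_of_mem_modularGroupReal (hΓ hA)) ε hε
  · exact ((hasSmallConjCovers_quatGroup ha hb hdiv hO.prop).of_relIndex_ne_zero hΓ hfin).traceMult_le
      (fun A hA => exists_int_trace_eq_of_mem_quatGroup hO.prop (hΓ hA)) ε hε
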